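/- Let $X$ be the surface of the regular octahedron with edge length $\sqrt3$, equipped with its intrinsic metric $d_X$ (infimum of lengths of paths in the surface), and let $A:X\to X$ be the antipodal map. For $p\in X$ let $\mathcal F_p$ be the set of points $q\in X$ that maximize $q\mapsto d_X(p,q)$; if $\mathcal F_p$ is a single point, call that point $F(p)$. Since $A$ is an isometry, $\mathcal F_{A(p)}=A(\mathcal F_p)$ for all $p$; put $f=F\circ A=A\circ F$ where $F$ is defined. Identify one face of $X$ isometrically with the triangle in $\mathbb C=\mathbb R^2$ whose vertices are the cube roots of unity, and let $T$ be the (closed) triangle with vertices $0$, $1$ and $\left(\tfrac14,\tfrac{\sqrt3}4\right)$ in it; the last point is called the top vertex. Let $r\approx 0.239123$ be the unique root of $x^3-x^2-4x+1$ in $(0,\tfrac14)$, and let $J$ be the graph of $$y=\frac1{\sqrt3}\Big(1-x-\big((2+x)(5-2x)(1-4x)\big)^{1/3}\Big),\qquad x\in[r,\tfrac14).$$ A point $(x,y)$ lies to the left (right) of $J$ if there is a point $(x',y)\in J$ with $x<x'$ (respectively $x>x'$). Put $$A_y=-y-\sqrt3,\quad B_y=\sqrt3\,y^2-y,\quad C_y=\sqrt3,\quad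 D_y=y-2\sqrt3 .$$ Then $J\subset T$, every point of $T-J$ other than the top vertex lies to the left or to the right of $J$, and the following hold. 1. If $p=(x,y)\in T-J$, then $\mathcal F_p$ is a single point. 2. If $p=(x,y)\in T-J$ lies to the left of $J$, then $$f(p)=\left(\frac{-xy-\sqrt3x+\sqrt3y^2-y}{\sqrt3x+y-2\sqrt3},\,y\right)=\left(\frac{A_yx+B_y}{C_yx+D_y},\,y\right).$$ 3. If $p=(x,y)\in T-J$ lies to the right of $J$, then $$f(p)=\left(\frac{-xy+2\sqrt3x+\sqrt3y^2-y}{\sqrt3x+y+\sqrt3},\,y\right)=\left(\frac{D_yx-B_y}{-C_yx+A_y},\,y\right).$$ 4. If $p$ is the top vertex of $T$, then $f(p)=p$. 5. If $p\in J$, then $A(\mathcal F_p)$ consists of exactly the two points given by the formulas in 2 and 3, and these two points are distinct (and lie in the same face). -/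

import Mathlib

noncomputable section

namespace OctahedronFarpoint

/-! ### The regular octahedron and its intrinsic metric -/

/-- The surface of the regular octahedron in `ℝ³` with vertices `± √(3/2) eᵢ`. The edges have
length `√3`, so each face is congruent to the triangle of the cube roots of unity in `ℂ`. -/
def octahedron : Set (EuclideanSpace ℝ (Fin 3)) :=
  {v | |v 0| + |v 1| + |v 2| = √(3 / 2)}

/-- The intrinsic distance: the infimum of the lengths of all paths in the surface. The length of
a path is its total variation for the Euclidean metric of `ℝ³`. -/
def intrinsicEDist (p q : octahedron) : ENNReal :=
  ⨅ γ : Path p q, eVariationOn γ Set.univ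

/-- The farthest-point set `F_p`: all maximizers of the intrinsic distance to `p`. -/
def farthestSet (p : octahedron) : Set octahedron :=
  {q | ∀ r, intrinsicEDist p r ≤ intrinsicEDist p q}

/-- The set `X'` of points whose farthest-point set is a single point. -/
def uniqueFar : Set octahedron :=
  {p | ∃ q, farthestSet p = {q}}

/-- The map `F : X' → X`, sending `p` to the unique member of `F_p`. -/
def farPoint (p : uniqueFar) : octahedron :=
  p.2.choose

/-- The antipodal map `A`. -/
def antipode (p : octahedron) : octahedron :=
  ⟨-p.1, by simpa [octahedron] using p.2⟩

/-- The map `f = A ∘ F` on `X'`. -/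
def farAntipode (p : uniqueFar) : octahedron :=
  antipode (farPoint p)

/-! ### Local coordinates on one face -/

/-- The triangle in the plane whose vertices are the cube roots of unity. -/
def face : Set ℂ :=
  convexHull ℝ {1, ⟨-1 / 2, √3 / 2⟩, ⟨-1 / 2, -(√3 / 2)⟩}

/-- The affine isometric map of the plane into `ℝ³` which sends the cube roots of unity
`1, ω, ω²` to the vertices `√(3/2) e₀, √(3/2) e₁, √(3/2) e₂` of the octahedron. -/
def chartMap (z : ℂ) : EuclideanSpace ℝ (Fin 3) :=
  √(3 / 2) • !₂[(1 + 2 * z.re) / 3, (1 - z.re + √3 * z.im) / 3, (1 - z.re - √3 * z.im) / 3]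

theorem face_subset :
    face ⊆ {z | 0 ≤ 1 + 2 * z.re ∧ 0 ≤ 1 - z.re + √3 * z.im ∧ 0 ≤ 1 - z.re - √3 * z.im} := by
  have h3 : √3 * √3 = 3 := Real.mul_self_sqrt (by norm_num)
  refine convexHull_min ?_ ?_
  · rintro z (rfl | rfl | rfl)
    · norm_num
    · refine ⟨?_, ?_, ?_⟩ <;> simp only <;> nlinarith
    · refine ⟨?_, ?_, ?_⟩ <;> simp only <;> nlinarith
  · rintro z ⟨hz1, hz2, hz3⟩ w ⟨hw1, hw2, hw3⟩ a b ha hb hab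
    obtain rfl : b = 1 - a := by linarith
    simp only [Set.mem_ofPred_eq, Complex.add_re, Complex.add_im, Complex.real_smul,
      Complex.mul_re, Complex.mul_im, Complex.ofReal_re, Complex.ofReal_im]
    refine ⟨?_, ?_, ?_⟩
    · linarith [mul_nonneg ha hz1, mul_nonneg hb hw1]
    · linarith [mul_nonneg ha hz2, mul_nonneg hb hw2]
    · linarith [mul_nonneg ha hz3, mul_nonneg hb hw3]

theorem chartMap_mem {z : ℂ} (hz : z ∈ face) : chartMap z ∈ octahedron := by
  obtain ⟨h1, h2, h3⟩ := face_subset hz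
  have hc : 0 ≤ √(3 / 2 : ℝ) := Real.sqrt_nonneg _
  simp only [octahedron, chartMap, Set.mem_ofPred_eq, PiLp.smul_apply, smul_eq_mul]
  simp only [Matrix.cons_val_zero, Matrix.cons_val_one, Matrix.cons_val]
  rw [abs_of_nonneg (by positivity), abs_of_nonneg (by positivity), abs_of_nonneg (by positivity)]
  ring

/-- The identification of the planar triangle with a face of the octahedron. -/
def chart (z : face) : octahedron :=
  ⟨chartMap z.1, chartMap_mem z.2⟩

/-- The top vertex of the fundamental domain. -/
def topVertex : ℂ := ⟨1 / 4, √3 / 4⟩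

/-- The fundamental domain `T`, one sixth of the face. -/
def domainT : Set ℂ :=
  convexHull ℝ {0, 1, topVertex}

theorem domainT_subset_face : domainT ⊆ face := by
  have hconv : Convex ℝ face := convex_convexHull ℝ _
  have h0 : (1 : ℂ) ∈ face := subset_convexHull ℝ _ (by simp)
  have h1 : (⟨-1 / 2, √3 / 2⟩ : ℂ) ∈ face := subset_convexHull ℝ _ (by simp)
  have h2 : (⟨-1 / 2, -(√3 / 2)⟩ : ℂ) ∈ face := subset_convexHull ℝ _ (by simp)
  refine convexHull_min ?_ hconv
  rintro z (rfl | rfl | rfl)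
  · have h3 := hconv h1 h2 (a := 1 / 2) (b := 1 / 2) (by norm_num) (by norm_num) (by norm_num)
    have h4 := hconv h0 h3 (a := 1 / 3) (b := 2 / 3) (by norm_num) (by norm_num) (by norm_num)
    convert h4 using 1
    apply Complex.ext <;> simp <;> norm_num
  · exact h0
  · have h3 := hconv h0 h1 (a := 1 / 2) (b := 1 / 2) (by norm_num) (by norm_num) (by norm_num)
    convert h3 using 1
    apply Complex.ext <;> (simp [topVertex]; try ring)

/-- The point of the octahedron given by a point of `T`. -/
def pointT (z : domainT) : octahedron :=
  chart ⟨z.1, domainT_subset_face z.2⟩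

/-! ### The curve `J` and the two branches -/

/-- The curve `J`: a graph over `[r, 1/4)`, where `r ≈ 0.239123` is the unique root of
`x³ - x² - 4x + 1` in `(0, 1/4)`. All radicands are positive on `[r, 1/4)`. -/
def curveJ : Set ℂ :=
  {z | ∃ r : ℝ, 0 < r ∧ r < 1 / 4 ∧ r ^ 3 - r ^ 2 - 4 * r + 1 = 0 ∧ r ≤ z.re ∧ z.re < 1 / 4 ∧
    z.im = 1 / √3 *
      (1 - z.re - ((2 + z.re) * (5 - 2 * z.re) * (1 - 4 * z.re)) ^ (1 / 3 : ℝ))}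

/-- `z` lies to the left of `J`, on the horizontal line through a point of `J`. -/
def LeftOfJ (z : ℂ) : Prop :=
  ∃ w ∈ curveJ, w.im = z.im ∧ z.re < w.re

/-- `z` lies to the right of `J`, on the horizontal line through a point of `J`. -/
def RightOfJ (z : ℂ) : Prop :=
  ∃ w ∈ curveJ, w.im = z.im ∧ w.re < z.re

/-- The formula for `f` on the left of `J`. -/
def leftBranch (z : ℂ) : ℂ :=
  ⟨(-z.re * z.im - √3 * z.re + √3 * z.im ^ 2 - z.im) / (√3 * z.re + z.im - 2 * √3), z.im⟩

/-- The formula for `f` on the right of `J`. -/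
def rightBranch (z : ℂ) : ℂ :=
  ⟨(-z.re * z.im + 2 * √3 * z.re + √3 * z.im ^ 2 - z.im) / (√3 * z.re + z.im + √3), z.im⟩

/-! The coefficients of the linear fractional maps in `x`. -/

def coeffA (y : ℝ) : ℝ := -y - √3

def coeffB (y : ℝ) : ℝ := √3 * y ^ 2 - y

def coeffC (_y : ℝ) : ℝ := √3

def coeffD (y : ℝ) : ℝ := y - 2 * √3

end OctahedronFarpoint

end

noncomputable section

namespace OctahedronFarpoint

open Set Filter Topology

/-! ### Elementary properties of the intrinsic distance -/

/-! The intrinsic distance from a point of the face `+++` is computed exactly. Crossing edges one at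
a time unfolds rows of at most four faces into the plane, and each row gives a Euclidean distance
`dev0`, `dev1`, `dev2` or `dev3`; `surfDist` is the minimum over the rows that flip exactly the
negative signs of the target, in some order. A row is a convex strip, so straight segments in it are
genuine paths, which gives the upper bound. For the lower bound no geodesics are studied: a function
that is `1`-Lipschitz on every face is dominated by the intrinsic distance
(`ofReal_sub_le_intrinsicEDist`), and `surfDist` is such a function because its facewise formulas
agree on common edges. The result is `intrinsicEDist_eq_surfDist`.

Since the unfolded distances are convex and the starting face has diameter `√3`, a bound `√R` with
`3 < R` on the opposite face is strict elsewhere (`surfDist_lt`), so every farthest point lies on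
the opposite face. Write `p = x + iY/√3`, and a point of that face as the antipode of `s + iW/√3`.
Two of the six unfoldings differ only by the sign of `3(W - Y)`, which favours the line `W = Y`,
where both have square `27/4 + (1/2 - x - s)²`. A third unfolding ties with them at `s = leftX`, a
fourth at `s = rightX`. Between these points the square is convex in `s`, and beyond them the third
or fourth unfolding takes over. Hence only the two ends can be farthest (`oppDist_lt`).

Which end wins depends on the larger of `leftGap²` and `rightGap²`. As `rightGap ≤ leftGap`, the
sign of the sum of the gaps decides, and this sum is a positive multiple of `curvePoly` (`gap_mul`).
This polynomial decreases in `x` and vanishes on `J`, so the left end wins to the left of `J`, the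
right end to the right, and they tie on `J`. -/

theorem intrinsicEDist_triangle (p q r : octahedron) :
    intrinsicEDist p r ≤ intrinsicEDist p q + intrinsicEDist q r := by
  unfold intrinsicEDist
  refine ENNReal.le_iInf_add_iInf fun γ δ => (iInf_le _ (γ.trans δ)).trans ?_
  let h : unitInterval := ⟨1 / 2, by norm_num, by norm_num⟩
  have hs : (univ : Set unitInterval) = Iic h ∪ Ici h := Iic_union_Ici.symm
  have hu : eVariationOn (γ.trans δ) univ =
      eVariationOn (γ.trans δ) (Iic h) + eVariationOn (γ.trans δ) (Ici h) := by
    rw [hs, eVariationOn.union (γ.trans δ) isGreatest_Iic isLeast_Ici]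
  rw [hu]
  refine add_le_add ?_ ?_
  · have h1 : EqOn (γ.trans δ) (γ ∘ fun t : unitInterval => projIcc 0 1 zero_le_one (2 * (t : ℝ)))
        (Iic h) := by
      intro t ht
      exact if_pos (show (t : ℝ) ≤ 1 / 2 from ht)
    rw [eVariationOn.congr h1]
    refine eVariationOn.comp_le_of_monotoneOn _ _ (fun s _ t _ hst => ?_) (mapsTo_univ _ _)
    exact monotone_projIcc _ (by have : (s : ℝ) ≤ t := hst; linarith)
  · have h1 : EqOn (γ.trans δ)
        (δ ∘ fun t : unitInterval => projIcc 0 1 zero_le_one (2 * (t : ℝ) - 1)) (Ici h) := by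
      intro t ht
      have ht' : (1 / 2 : ℝ) ≤ t := ht
      -- At the midpoint itself the concatenated path is still given by the first piece, so this
      -- endpoint is matched by hand.
      rcases ht'.eq_or_lt with heq | hlt
      · have h2 : projIcc (0 : ℝ) 1 zero_le_one (2 * (t : ℝ) - 1) = 0 :=
          projIcc_of_le_left _ (by linarith)
        simp only [Function.comp_apply, h2, δ.source]
        have h3 : (γ.trans δ) t = γ.extend (2 * (t : ℝ)) := if_pos heq.ge
        rw [h3, ← heq]
        norm_num
      · exact if_neg (not_le.2 hlt)
    rw [eVariationOn.congr h1]
    refine eVariationOn.comp_le_of_monotoneOn _ _ (fun s _ t _ hst => ?_) (mapsTo_univ _ _)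
    exact monotone_projIcc _ (by have : (s : ℝ) ≤ t := hst; linarith)

theorem intrinsicEDist_antipode_le (p q : octahedron) :
    intrinsicEDist (antipode p) (antipode q) ≤ intrinsicEDist p q := by
  have hc : Continuous antipode := by
    unfold antipode; fun_prop
  refine le_iInf fun γ => (iInf_le _ (γ.map hc)).trans ?_
  have hl : LipschitzOnWith 1 antipode univ := by
    intro u _ v _
    simp only [antipode, Subtype.edist_eq, edist_neg_neg, ENNReal.coe_one, one_mul, le_refl]
  simpa using hl.comp_eVariationOn_le (mapsTo_univ γ univ)

theorem antipode_antipode (p : octahedron) : antipode (antipode p) = p :=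
  Subtype.ext (neg_neg _)

theorem intrinsicEDist_antipode (p q : octahedron) :
    intrinsicEDist (antipode p) (antipode q) = intrinsicEDist p q := by
  refine le_antisymm (intrinsicEDist_antipode_le p q) ?_
  simpa only [antipode_antipode] using intrinsicEDist_antipode_le (antipode p) (antipode q)

theorem farthestSet_antipode (p : octahedron) :
    farthestSet (antipode p) = antipode '' farthestSet p := by
  have key : ∀ q, antipode q ∈ farthestSet (antipode p) ↔ q ∈ farthestSet p := by
    intro q
    constructor
    · intro h r
      simpa only [intrinsicEDist_antipode] using h (antipode r)
    · intro h r
      rw [← antipode_antipode r]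
      simpa only [intrinsicEDist_antipode] using h (antipode r)
  ext q
  constructor
  · intro h
    refine ⟨antipode q, (key _).1 ?_, antipode_antipode q⟩
    rwa [antipode_antipode]
  · rintro ⟨r, hr, rfl⟩
    exact (key r).2 hr

theorem abs_convexComb {x y : ℝ} (hxy : 0 ≤ x * y) {s t : ℝ} (hs : 0 ≤ s) (ht : 0 ≤ t) :
    |s * x + t * y| = s * |x| + t * |y| := by
  have h : 0 ≤ (s * x) * (t * y) := by
    have := mul_nonneg (mul_nonneg hs ht) hxy
    linarith
  rw [abs_add_eq_add_abs_iff _ _ |>.2 ?_, abs_mul, abs_mul, abs_of_nonneg hs, abs_of_nonneg ht]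
  rcases mul_nonneg_iff.1 h with h | h
  · exact Or.inl h
  · exact Or.inr h

/-- The intrinsic distance of two points of the same face is at most their Euclidean distance. -/
theorem intrinsicEDist_le_edist (u v : octahedron) (h : ∀ m, 0 ≤ u.1 m * v.1 m) :
    intrinsicEDist u v ≤ edist u v := by
  have hmem : ∀ t : unitInterval, AffineMap.lineMap u.1 v.1 (t : ℝ) ∈ octahedron := by
    intro t
    have hu := u.2
    have hv := v.2
    simp only [octahedron, mem_ofPred_eq] at hu hv ⊢
    have hm : ∀ m, |(AffineMap.lineMap u.1 v.1 (t : ℝ) : EuclideanSpace ℝ (Fin 3)) m| =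
        (1 - t) * |u.1 m| + t * |v.1 m| := by
      intro m
      rw [← abs_convexComb (h m) (by linarith [t.2.2]) t.2.1]
      simp [AffineMap.lineMap_apply_module]
    rw [hm, hm, hm]
    linear_combination (1 - (t : ℝ)) * hu + t * hv
  let γ : Path u v :=
    { toFun := fun t => ⟨AffineMap.lineMap u.1 v.1 (t : ℝ), hmem t⟩
      continuous_toFun := by
        refine Continuous.subtype_mk ?_ _
        exact AffineMap.lineMap_continuous.comp continuous_subtype_val
      source' := by simp
      target' := by simp }
  refine (iInf_le _ γ).trans ?_
  have hl : LipschitzOnWith (nndist u.1 v.1)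
      (AffineMap.lineMap u.1 v.1 : ℝ → EuclideanSpace ℝ (Fin 3)) univ :=
    (lipschitzWith_lineMap u.1 v.1).lipschitzOnWith
  have h1 := hl.comp_eVariationOn_le (mapsTo_univ (Subtype.val : unitInterval → ℝ) univ)
  have h2 : eVariationOn (Subtype.val : unitInterval → ℝ) univ ≤ 1 := by
    have h3 := MonotoneOn.eVariationOn_eq (f := (Subtype.val : unitInterval → ℝ)) (s := univ)
      (Subtype.mono_coe _ |>.monotoneOn _) (mem_univ 0) (mem_univ 1)
    have h4 : (univ ∩ Icc 0 1 : Set unitInterval) = univ := by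
      ext t
      simp [unitInterval.le_one']
    rw [h4] at h3
    simp [h3]
  calc eVariationOn γ univ
      = eVariationOn ((AffineMap.lineMap u.1 v.1 : ℝ → EuclideanSpace ℝ (Fin 3)) ∘
          (Subtype.val : unitInterval → ℝ)) univ := rfl
    _ ≤ nndist u.1 v.1 * 1 := h1.trans (mul_le_mul_right h2 _)
    _ = edist u v := by rw [mul_one, Subtype.edist_eq, edist_nndist]

/-- Points of the surface near `u` share a face with `u`. -/
theorem eventually_mul_nonneg (u : octahedron) :
    ∀ᶠ v in 𝓝 u, ∀ m, 0 ≤ u.1 m * v.1 m := by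
  rw [eventually_all]
  intro m
  rcases eq_or_ne (u.1 m) 0 with h | h
  · simp [h]
  · have hc : Continuous fun v : octahedron => u.1 m * v.1 m := by fun_prop
    have h0 : 0 < u.1 m * u.1 m := mul_self_pos.2 h
    exact (hc.continuousAt.eventually (lt_mem_nhds h0)).mono fun v hv => hv.le

/-- A function which is `1`-Lipschitz on every face is bounded by the intrinsic distance. -/
theorem ofReal_sub_le_intrinsicEDist (D : octahedron → ℝ)
    (hD : ∀ u v : octahedron, (∀ m, 0 ≤ u.1 m * v.1 m) → D v ≤ D u + dist u v)
    (p q : octahedron) :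
    ENNReal.ofReal (D q - D p) ≤ intrinsicEDist p q := by
  refine le_iInf fun γ => ?_
  have step : ∀ s t : unitInterval, s ≤ t → (∀ m, 0 ≤ (γ s).1 m * (γ t).1 m) →
      ENNReal.ofReal (D (γ s) - D p) ≤ eVariationOn γ (Icc 0 s) →
      ENNReal.ofReal (D (γ t) - D p) ≤ eVariationOn γ (Icc 0 t) := by
    intro s t hst hc hs
    have h1 := eVariationOn.Icc_add_Icc γ (s := univ) (a := 0) (b := s) (c := t)
      unitInterval.nonneg' hst (mem_univ _)
    simp only [univ_inter] at h1
    have h2 : edist (γ s) (γ t) ≤ eVariationOn γ (Icc s t) :=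
      eVariationOn.edist_le _ ⟨le_rfl, hst⟩ ⟨hst, le_rfl⟩
    calc ENNReal.ofReal (D (γ t) - D p)
        ≤ ENNReal.ofReal ((D (γ s) - D p) + dist (γ s) (γ t)) :=
          ENNReal.ofReal_le_ofReal (by linarith [hD _ _ hc])
      _ ≤ ENNReal.ofReal (D (γ s) - D p) + ENNReal.ofReal (dist (γ s) (γ t)) :=
          ENNReal.ofReal_add_le
      _ ≤ eVariationOn γ (Icc 0 s) + eVariationOn γ (Icc s t) := by
          rw [← edist_dist]; exact add_le_add hs h2
      _ = _ := h1
  -- Continuous induction along `γ`. Closedness of `S` is not known, so `t₀` is the last point of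
  -- its closure. Near `t₀` the path shares a face with `γ t₀`; hence the bound passes from earlier
  -- times to `t₀`, and from `t₀` to a later time if `t₀ < 1`.
  let S : Set unitInterval := {t | ENNReal.ofReal (D (γ t) - D p) ≤ eVariationOn γ (Icc 0 t)}
  have h0S : (0 : unitInterval) ∈ S := by simp [S]
  obtain ⟨t₀, ht₀, hmax⟩ := (isClosed_closure (s := S)).isCompact.exists_isGreatest
    ⟨0, subset_closure h0S⟩
  have hnear : ∀ᶠ t in 𝓝 t₀, ∀ m, 0 ≤ (γ t₀).1 m * (γ t).1 m :=
    γ.continuous.continuousAt.eventually (eventually_mul_nonneg (γ t₀))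
  have ht₀S : t₀ ∈ S := by
    obtain ⟨t, ht, htS⟩ := ((mem_closure_iff_frequently.1 ht₀).and_eventually hnear).exists
    exact step t t₀ (hmax (subset_closure ht)) (fun m => by rw [mul_comm]; exact htS m) ht
  have ht1 : t₀ = 1 := by
    by_contra hne
    have hlt : t₀ < 1 := lt_of_le_of_ne unitInterval.le_one' hne
    have : (𝓝[>] t₀).NeBot := nhdsGT_neBot_of_exists_gt ⟨1, hlt⟩
    obtain ⟨t, ht, hgt⟩ :=
      ((hnear.filter_mono nhdsWithin_le_nhds).and
        (self_mem_nhdsWithin (a := t₀) (s := Ioi t₀))).exists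
    exact absurd (hmax (subset_closure (step t₀ t (le_of_lt hgt) ht ht₀S))) (not_le.2 hgt)
  have := ht₀S
  simp only [S, ht1, mem_ofPred_eq, γ.target] at this
  exact this.trans (eVariationOn.mono _ (subset_univ _))

/-! ### Lengths in the unfolded surface -/

/-- The Euclidean length in the plane tiled by the faces, in coordinates `u` (half edges along a
row of triangles) and `v` (heights across the row). -/
def hexNorm (u v : ℝ) : ℝ := √(3 / 4 * u ^ 2 + 9 / 4 * v ^ 2)

theorem hexNorm_nonneg (u v : ℝ) : 0 ≤ hexNorm u v := Real.sqrt_nonneg _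

theorem hexNorm_eq_norm (u v : ℝ) : hexNorm u v = ‖(⟨√3 / 2 * u, 3 / 2 * v⟩ : ℂ)‖ := by
  have h3 : √3 ^ 2 = (3 : ℝ) := Real.sq_sqrt (by norm_num)
  rw [Complex.norm_def, Complex.normSq_mk, hexNorm]
  congr 1
  linear_combination (-(1 / 4) * u ^ 2) * h3

theorem hexNorm_add_le (u v u' v' : ℝ) :
    hexNorm (u + u') (v + v') ≤ hexNorm u v + hexNorm u' v' := by
  simp only [hexNorm_eq_norm]
  refine le_of_eq_of_le ?_ (norm_add_le _ _)
  congr 1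
  apply Complex.ext <;> simp <;> ring

theorem hexNorm_mul {t : ℝ} (ht : 0 ≤ t) (u v : ℝ) :
    hexNorm (t * u) (t * v) = t * hexNorm u v := by
  unfold hexNorm
  rw [show 3 / 4 * (t * u) ^ 2 + 9 / 4 * (t * v) ^ 2 =
      t ^ 2 * (3 / 4 * u ^ 2 + 9 / 4 * v ^ 2) by ring,
    Real.sqrt_mul (sq_nonneg t), Real.sqrt_sq ht]

theorem hexNorm_neg_right (u v : ℝ) : hexNorm u (-v) = hexNorm u v := by
  simp [hexNorm]

/-- On the plane `x + y + z = 0` the form is `3/2 (x² + y² + z²)`, so it does not see which edge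
direction is taken as the row. -/
theorem hexNorm_rotate {x y z : ℝ} (h : x + y + z = 0) :
    hexNorm (z - x) y = hexNorm (x - y) z := by
  obtain rfl : z = -x - y := by linarith
  unfold hexNorm
  congr 1
  ring

theorem hexNorm_le_hexNorm {u v u' v' : ℝ}
    (h : 3 / 4 * u ^ 2 + 9 / 4 * v ^ 2 ≤ 3 / 4 * u' ^ 2 + 9 / 4 * v' ^ 2) :
    hexNorm u v ≤ hexNorm u' v' :=
  Real.sqrt_le_sqrt h

theorem sum_perm (σ : Equiv.Perm (Fin 3)) (f : Fin 3 → ℝ) :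
    f (σ 0) + f (σ 1) + f (σ 2) = f 0 + f 1 + f 2 := by
  simpa [Fin.sum_univ_three] using Equiv.sum_comp σ f

/-! ### Points of the surface in normalized coordinates -/

/-- The point of the octahedron with normalized coordinates `v`. -/
def octPoint (v : Fin 3 → ℝ) (h : |v 0| + |v 1| + |v 2| = 1) : octahedron :=
  ⟨√(3 / 2) • WithLp.toLp 2 v, by
    simp only [octahedron, mem_ofPred_eq, PiLp.smul_apply, smul_eq_mul, abs_mul,
      abs_of_nonneg (Real.sqrt_nonneg _)]
    linear_combination √(3 / 2) * h⟩

theorem sqrt_three_halves_pos : 0 < √(3 / 2 : ℝ) := by positivity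

/-- The normalized coordinates of a point of the octahedron. -/
def coords (q : octahedron) (m : Fin 3) : ℝ := q.1 m / √(3 / 2)

theorem sum_abs_coords (q : octahedron) :
    |coords q 0| + |coords q 1| + |coords q 2| = 1 := by
  have h := q.2
  have hc := sqrt_three_halves_pos
  simp only [octahedron, mem_ofPred_eq] at h
  simp only [coords, abs_div, abs_of_pos hc]
  rw [← add_div, ← add_div, h, div_self hc.ne']

theorem octPoint_coords (q : octahedron) : octPoint (coords q) (sum_abs_coords q) = q := by
  apply Subtype.ext
  ext m
  simp only [octPoint, coords, PiLp.smul_apply, smul_eq_mul]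
  exact mul_div_cancel₀ _ sqrt_three_halves_pos.ne'

theorem coords_octPoint (v : Fin 3 → ℝ) (h : |v 0| + |v 1| + |v 2| = 1) :
    coords (octPoint v h) = v := by
  ext m
  simp only [octPoint, coords, PiLp.smul_apply, smul_eq_mul]
  exact mul_div_cancel_left₀ _ sqrt_three_halves_pos.ne'

theorem coords_injective : Function.Injective coords := by
  intro p q h
  rw [← octPoint_coords p, ← octPoint_coords q]
  simp only [h]

theorem coords_antipode (q : octahedron) (m : Fin 3) : coords (antipode q) m = -coords q m := by
  simp [coords, antipode, neg_div]

theorem coords_mul_nonneg {u v : octahedron} {m : Fin 3} :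
    0 ≤ coords u m * coords v m ↔ 0 ≤ u.1 m * v.1 m := by
  have hc := sqrt_three_halves_pos
  have : coords u m * coords v m = u.1 m * v.1 m / (√(3 / 2) * √(3 / 2)) := by
    simp only [coords]
    ring
  rw [this, le_div_iff₀ (by positivity), zero_mul]

theorem sq_sub_of_mul_nonneg {x y : ℝ} (h : 0 ≤ x * y) : (x - y) ^ 2 = (|y| - |x|) ^ 2 := by
  have h1 : |x| * |y| = x * y := by rw [← abs_mul, abs_of_nonneg h]
  nlinarith [sq_abs x, sq_abs y]

/-- The Euclidean distance of two points of the same face. -/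
theorem dist_eq_hexNorm (σ : Equiv.Perm (Fin 3)) (u v : octahedron)
    (h : ∀ m, 0 ≤ coords u m * coords v m) :
    dist u v = hexNorm
      ((|coords v (σ 2)| - |coords u (σ 2)|) - (|coords v (σ 0)| - |coords u (σ 0)|))
      (|coords v (σ 1)| - |coords u (σ 1)|) := by
  have hu : ∀ m, u.1 m = √(3 / 2) * coords u m := fun m =>
    (mul_div_cancel₀ _ sqrt_three_halves_pos.ne').symm
  have hv : ∀ m, v.1 m = √(3 / 2) * coords v m := fun m =>
    (mul_div_cancel₀ _ sqrt_three_halves_pos.ne').symm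
  have hc : √(3 / 2 : ℝ) ^ 2 = 3 / 2 := Real.sq_sqrt (by norm_num)
  rw [Subtype.dist_eq, EuclideanSpace.dist_eq, hexNorm]
  congr 1
  have hm : ∀ m, dist (u.1 m) (v.1 m) ^ 2 =
      3 / 2 * (|coords v m| - |coords u m|) ^ 2 := by
    intro m
    rw [← sq_sub_of_mul_nonneg (h m), Real.dist_eq, sq_abs, hu, hv, ← mul_sub, mul_pow, hc]
  simp only [hm]
  rw [← Equiv.sum_comp σ, Fin.sum_univ_three]
  have s1 := (sum_perm σ fun m => |coords u m|).trans (sum_abs_coords u)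
  have s2 := (sum_perm σ fun m => |coords v m|).trans (sum_abs_coords v)
  have h1 : |coords u (σ 1)| = 1 - |coords u (σ 0)| - |coords u (σ 2)| := by linarith
  have h2 : |coords v (σ 1)| = 1 - |coords v (σ 0)| - |coords v (σ 2)| := by linarith
  rw [h1, h2]
  ring

/-! ### Paths along rows of faces -/

/-- The points with normalized coordinates `u` and `v` are at intrinsic distance at most `L`. -/
def Reach (u v : Fin 3 → ℝ) (L : ℝ) : Prop :=
  ∃ hu hv, intrinsicEDist (octPoint u hu) (octPoint v hv) ≤ ENNReal.ofReal L

theorem Reach.trans {u v w : Fin 3 → ℝ} {L M : ℝ} (h₁ : Reach u v L) (h₂ : Reach v w M)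
    (hL : 0 ≤ L) (hM : 0 ≤ M) : Reach u w (L + M) := by
  obtain ⟨hu, hv, h⟩ := h₁
  obtain ⟨_, hw, h'⟩ := h₂
  refine ⟨hu, hw, (intrinsicEDist_triangle _ (octPoint v hv) _).trans ?_⟩
  rw [ENNReal.ofReal_add hL hM]
  exact add_le_add h h'

theorem reach_of_mul_nonneg (σ : Equiv.Perm (Fin 3)) {u v : Fin 3 → ℝ}
    (hu : |u 0| + |u 1| + |u 2| = 1) (hv : |v 0| + |v 1| + |v 2| = 1)
    (h : ∀ m, 0 ≤ u (σ m) * v (σ m)) :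
    Reach u v (hexNorm ((|v (σ 2)| - |u (σ 2)|) - (|v (σ 0)| - |u (σ 0)|))
      (|v (σ 1)| - |u (σ 1)|)) := by
  have h' : ∀ m, 0 ≤ coords (octPoint u hu) m * coords (octPoint v hv) m := by
    intro m
    rw [coords_octPoint, coords_octPoint]
    simpa using h (σ.symm m)
  refine ⟨hu, hv, (intrinsicEDist_le_edist _ _ fun m => coords_mul_nonneg.1 (h' m)).trans ?_⟩
  rw [edist_dist, dist_eq_hexNorm σ _ _ h', coords_octPoint, coords_octPoint]

/-- This is the parameter at which a segment meets a line that has its ends at heights `A` and `-B`;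
the value `0` serves when both heights vanish. -/
theorem exists_crossing {A B : ℝ} (hA : 0 ≤ A) (hB : 0 ≤ B) :
    ∃ t, 0 ≤ t ∧ t ≤ 1 ∧ (1 - t) * A = t * B := by
  rcases (add_nonneg hA hB).eq_or_lt with h | h
  · exact ⟨0, le_rfl, zero_le_one, by linarith⟩
  · refine ⟨A / (A + B), by positivity, by rw [div_le_one h]; linarith, ?_⟩
    field_simp
    ring

theorem hexNorm_split {t : ℝ} (h0 : 0 ≤ t) (h1 : t ≤ 1) (u v : ℝ) :
    hexNorm (t * u) (t * v) + hexNorm ((1 - t) * u) ((1 - t) * v) = hexNorm u v := by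
  rw [hexNorm_mul h0, hexNorm_mul (sub_nonneg.2 h1)]
  ring

/-- A straight path through a row of two faces. -/
theorem reach_two_faces (σ : Equiv.Perm (Fin 3)) {a v : Fin 3 → ℝ}
    (ha : ∀ m, 0 ≤ a m) (ha1 : a 0 + a 1 + a 2 = 1) (hv1 : |v 0| + |v 1| + |v 2| = 1)
    (h0 : v (σ 0) ≤ 0) (h1 : 0 ≤ v (σ 1)) (h2 : 0 ≤ v (σ 2)) :
    Reach a v (hexNorm (1 - v (σ 0) - v (σ 1) + a (σ 0) - a (σ 2))
      (-v (σ 0) + v (σ 1) - a (σ 1))) := by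
  have sa := (sum_perm σ a).trans ha1
  have sv := (sum_perm σ fun m => |v m|).trans hv1
  simp only [abs_of_nonpos h0, abs_of_nonneg h1, abs_of_nonneg h2] at sv
  have a0 := ha (σ 0)
  have a1 := ha (σ 1)
  have a2 := ha (σ 2)
  obtain ⟨t, t0, t1, ht⟩ := exists_crossing a0 (neg_nonneg.2 h0)
  -- The height of the crossing point in the row. Both ends have height in `[0, 1]`, so the segment
  -- does cross the shared edge and not its extension.
  obtain ⟨m, hm⟩ : ∃ m, m = (1 - t) * a (σ 1) + t * (-v (σ 0) + v (σ 1)) := ⟨_, rfl⟩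
  have m0 : 0 ≤ m := by
    rw [hm]
    have := mul_nonneg (sub_nonneg.2 t1) a1
    have := mul_nonneg t0 (by linarith : 0 ≤ -v (σ 0) + v (σ 1))
    linarith
  have m1 : m ≤ 1 := by
    have := mul_nonneg (sub_nonneg.2 t1) (by linarith : 0 ≤ 1 - a (σ 1))
    have := mul_nonneg t0 (by linarith : 0 ≤ 1 - (-v (σ 0) + v (σ 1)))
    linarith
  have m1' : 0 ≤ 1 - m := by linarith
  let y : Fin 3 → ℝ := ![0, m, 1 - m] ∘ σ.symm
  have y0 : y (σ 0) = 0 := by simp [y]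
  have y1 : y (σ 1) = m := by simp [y]
  have y2 : y (σ 2) = 1 - m := by simp [y]
  have hy : |y 0| + |y 1| + |y 2| = 1 := by
    rw [← sum_perm σ fun m => |y m|]
    simp only [y0, y1, y2, abs_zero, abs_of_nonneg m0, abs_of_nonneg m1']
    ring
  have r1 := reach_of_mul_nonneg σ (u := a) (v := y)
    (by simpa only [abs_of_nonneg (ha _)] using ha1) hy (by
      intro n
      fin_cases n
      · simp [y0]
      · simpa [y1] using mul_nonneg a1 m0
      · simpa [y2] using mul_nonneg a2 m1')
  have r2 := reach_of_mul_nonneg σ (u := y) (v := v) hy hv1 (by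
      intro n
      fin_cases n
      · simp [y0]
      · simpa [y1] using mul_nonneg m0 h1
      · simpa [y2] using mul_nonneg m1' h2)
  have r := r1.trans r2 (hexNorm_nonneg _ _) (hexNorm_nonneg _ _)
  simp only [y0, y1, y2, abs_zero, abs_of_nonneg a0, abs_of_nonneg a1, abs_of_nonneg a2,
    abs_of_nonneg m0, abs_of_nonneg m1', abs_of_nonpos h0, abs_of_nonneg h1,
    abs_of_nonneg h2] at r
  -- The second leg is turned and reflected into the coordinates of the row; there the two legs are
  -- the fractions `t` and `1 - t` of one vector.
  rw [hexNorm_rotate (x := -v (σ 0) - 0) (y := v (σ 1) - m) (z := v (σ 2) - (1 - m))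
    (by linarith), ← hexNorm_neg_right (-v (σ 0) - 0 - _)] at r
  convert r using 1
  rw [← hexNorm_split t0 t1]
  congr 2
  · rw [hm]; linear_combination (1 - t) * sa - 2 * ht
  · rw [hm]; ring
  · rw [hm]; linear_combination 2 * ht - (1 - t) * sa
  · rw [hm]; linear_combination sv

/-- A straight path through a row of three faces. -/
theorem reach_three_faces (σ : Equiv.Perm (Fin 3)) {a v : Fin 3 → ℝ}
    (ha : ∀ m, 0 ≤ a m) (ha1 : a 0 + a 1 + a 2 = 1) (hv1 : |v 0| + |v 1| + |v 2| = 1)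
    (h0 : v (σ 0) ≤ 0) (h1 : v (σ 1) ≤ 0) (h2 : 0 ≤ v (σ 2)) :
    Reach a v (hexNorm (2 - v (σ 1) - v (σ 2) + a (σ 0) - a (σ 2)) (-v (σ 0) - a (σ 1))) := by
  have sa := (sum_perm σ a).trans ha1
  have sv := (sum_perm σ fun m => |v m|).trans hv1
  simp only [abs_of_nonpos h0, abs_of_nonpos h1, abs_of_nonneg h2] at sv
  have a0 := ha (σ 0)
  have a1 := ha (σ 1)
  have a2 := ha (σ 2)
  -- `1 - a (σ 2)` is the affine extension, back to the starting face, of the coordinate that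
  -- vanishes on the last edge of the row.
  obtain ⟨t, t0, t1, ht⟩ := exists_crossing (A := 1 - a (σ 2)) (B := -v (σ 1))
    (by linarith) (by linarith)
  obtain ⟨m, hm⟩ : ∃ m, m = (1 - t) * a (σ 1) + t * (-v (σ 0)) := ⟨_, rfl⟩
  have m0 : 0 ≤ m := by
    rw [hm]
    have := mul_nonneg (sub_nonneg.2 t1) a1
    have := mul_nonneg t0 (by linarith : 0 ≤ -v (σ 0))
    linarith
  have m1 : m ≤ 1 := by
    have := mul_nonneg (sub_nonneg.2 t1) (by linarith : 0 ≤ 1 - a (σ 1))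
    have := mul_nonneg t0 (by linarith : 0 ≤ 1 - (-v (σ 0)))
    linarith
  have m1' : 0 ≤ 1 - m := by linarith
  let y : Fin 3 → ℝ := ![-m, 0, 1 - m] ∘ σ.symm
  have y0 : y (σ 0) = -m := by simp [y]
  have y1 : y (σ 1) = 0 := by simp [y]
  have y2 : y (σ 2) = 1 - m := by simp [y]
  have hy : |y 0| + |y 1| + |y 2| = 1 := by
    rw [← sum_perm σ fun m => |y m|]
    simp only [y0, y1, y2, abs_neg, abs_zero, abs_of_nonneg m0, abs_of_nonneg m1']
    ring
  have r1 := reach_two_faces σ (v := y) ha ha1 hy (by linarith) (by linarith) (by linarith)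
  have r2 := reach_of_mul_nonneg σ (u := y) (v := v) hy hv1 (by
      intro n
      fin_cases n
      · simpa [y0] using mul_nonneg m0 (neg_nonneg.2 h0)
      · simp [y1]
      · simpa [y2] using mul_nonneg m1' h2)
  have r := r1.trans r2 (hexNorm_nonneg _ _) (hexNorm_nonneg _ _)
  simp only [y0, y1, y2, abs_neg, abs_zero, abs_of_nonneg m0, abs_of_nonneg m1',
    abs_of_nonpos h0, abs_of_nonpos h1, abs_of_nonneg h2] at r
  rw [hexNorm_rotate (x := -v (σ 0) - m) (y := -v (σ 1) - 0) (z := v (σ 2) - (1 - m))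
    (by linarith), hexNorm_rotate (x := -v (σ 1) - 0) (y := v (σ 2) - (1 - m)) (z := -v (σ 0) - m)
    (by linarith)] at r
  convert r using 1
  rw [← hexNorm_split t0 t1]
  congr 2
  · rw [hm]; linear_combination -2 * ht - t * sv - (1 - t) * sa
  · rw [hm]; ring
  · rw [hm]; linear_combination 2 * ht + t * sv + (1 - t) * sa
  · rw [hm]; ring

/-- A straight path through a row of four faces. -/
theorem reach_four_faces (σ : Equiv.Perm (Fin 3)) {a v : Fin 3 → ℝ}
    (ha : ∀ m, 0 ≤ a m) (ha1 : a 0 + a 1 + a 2 = 1) (hv1 : |v 0| + |v 1| + |v 2| = 1)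
    (h0 : v (σ 0) ≤ 0) (h1 : v (σ 1) ≤ 0) (h2 : v (σ 2) ≤ 0) :
    Reach a v (hexNorm (3 - v (σ 2) + v (σ 0) + a (σ 0) - a (σ 2)) (1 + v (σ 1) - a (σ 1))) := by
  have sa := (sum_perm σ a).trans ha1
  have sv := (sum_perm σ fun m => |v m|).trans hv1
  simp only [abs_of_nonpos h0, abs_of_nonpos h1, abs_of_nonpos h2] at sv
  have a0 := ha (σ 0)
  have a1 := ha (σ 1)
  have a2 := ha (σ 2)
  -- Extended affinely along the row, the coordinate vanishing on the last edge takes the value `1 +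
  -- a (σ 0)` at the start.
  obtain ⟨t, t0, t1, ht⟩ := exists_crossing (A := 1 + a (σ 0)) (B := -v (σ 2))
    (by linarith) (by linarith)
  obtain ⟨m, hm⟩ : ∃ m, m = (1 - t) * a (σ 1) + t * (1 + v (σ 1)) := ⟨_, rfl⟩
  have m0 : 0 ≤ m := by
    rw [hm]
    have := mul_nonneg (sub_nonneg.2 t1) a1
    have := mul_nonneg t0 (by linarith : 0 ≤ 1 + v (σ 1))
    linarith
  have m1 : m ≤ 1 := by
    have := mul_nonneg (sub_nonneg.2 t1) (by linarith : 0 ≤ 1 - a (σ 1))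
    have := mul_nonneg t0 (by linarith : 0 ≤ 1 - (1 + v (σ 1)))
    linarith
  have m1' : 0 ≤ 1 - m := by linarith
  let y : Fin 3 → ℝ := ![-m, -(1 - m), 0] ∘ σ.symm
  have y0 : y (σ 0) = -m := by simp [y]
  have y1 : y (σ 1) = -(1 - m) := by simp [y]
  have y2 : y (σ 2) = 0 := by simp [y]
  have hy : |y 0| + |y 1| + |y 2| = 1 := by
    rw [← sum_perm σ fun m => |y m|]
    simp only [y0, y1, y2, abs_neg, abs_zero, abs_of_nonneg m0, abs_of_nonneg m1']
    ring
  have r1 := reach_three_faces σ (v := y) ha ha1 hy (by linarith) (by linarith) (by linarith)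
  have r2 := reach_of_mul_nonneg σ (u := y) (v := v) hy hv1 (by
      intro n
      fin_cases n
      · simpa [y0] using mul_nonneg m0 (neg_nonneg.2 h0)
      · simpa [y1] using mul_nonneg_of_nonpos_of_nonpos (by linarith : m - 1 ≤ 0) h1
      · simp [y2])
  have r := r1.trans r2 (hexNorm_nonneg _ _) (hexNorm_nonneg _ _)
  simp only [y0, y1, y2, abs_neg, abs_zero, abs_of_nonneg m0, abs_of_nonneg m1',
    abs_of_nonpos h0, abs_of_nonpos h1, abs_of_nonpos h2] at r
  rw [← hexNorm_neg_right (-v (σ 2) - 0 - _)] at r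
  convert r using 1
  rw [← hexNorm_split t0 t1]
  congr 2
  · rw [hm]; linear_combination -2 * ht - t * sv + (1 - t) * sa
  · rw [hm]; ring
  · rw [hm]; linear_combination 2 * ht + t * sv - (1 - t) * sa
  · rw [hm]; ring

/-! ### Unfolded distances -/

/-- The distance from the point with barycentric coordinates `a` on the face `+++` to the point
with barycentric coordinates `b` on the same face. -/
def dev0 (i j k : Fin 3) (a b : Fin 3 → ℝ) : ℝ :=
  hexNorm (b k - b i + a i - a k) (b j - a j)

/-- The distance in the plane after unfolding the face obtained by flipping the sign `i`. -/
def dev1 (i j k : Fin 3) (a b : Fin 3 → ℝ) : ℝ :=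
  hexNorm (1 + b i - b j + a i - a k) (b i + b j - a j)

/-- The distance in the plane after unfolding the faces obtained by flipping the signs `i`, `j` in
this order. -/
def dev2 (i j k : Fin 3) (a b : Fin 3 → ℝ) : ℝ :=
  hexNorm (2 + b j - b k + a i - a k) (b i - a j)

/-- The distance in the plane after unfolding the faces obtained by flipping the signs `i`, `j`,
`k` in this order. -/
def dev3 (i j k : Fin 3) (a b : Fin 3 → ℝ) : ℝ :=
  hexNorm (3 + b k - b i + a i - a k) (1 - b j - a j)

/-- Barycentric coordinates of a point of a face. -/
structure IsBary (a : Fin 3 → ℝ) : Prop where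
  nonneg : ∀ m, 0 ≤ a m
  sum : a 0 + a 1 + a 2 = 1

/-! ### Comparison of unfoldings along common edges -/

section edges

variable {i j k : Fin 3} {a b : Fin 3 → ℝ}

theorem dev0_rotate (ha : a i + a j + a k = 1) (hb : b i + b j + b k = 1) :
    dev0 j k i a b = dev0 i j k a b := by
  have hk : b k = 1 - b i - b j := by linarith
  have hk' : a k = 1 - a i - a j := by linarith
  unfold dev0 hexNorm
  rw [hk, hk']
  congr 1
  ring

theorem dev1_swap (ha : a i + a j + a k = 1) (hb : b i + b j + b k = 1) :
    dev1 i k j a b = dev1 i j k a b := by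
  have hk : b k = 1 - b i - b j := by linarith
  have hk' : a k = 1 - a i - a j := by linarith
  unfold dev1 hexNorm
  rw [hk, hk']
  congr 1
  ring

theorem dev1_eq_dev0 (hb : b i + b j + b k = 1) (h : b i = 0) :
    dev1 i j k a b = dev0 i j k a b := by
  unfold dev1 dev0
  congr 1 <;> linarith

theorem dev2_eq_dev1 (hb : b i + b j + b k = 1) (h : b j = 0) :
    dev2 i j k a b = dev1 i j k a b := by
  unfold dev2 dev1
  congr 1 <;> linarith

theorem dev3_eq_dev2 (hb : b i + b j + b k = 1) (h : b k = 0) :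
    dev3 i j k a b = dev2 i j k a b := by
  unfold dev3 dev2
  congr 1 <;> linarith

variable (ha0 : ∀ m, 0 ≤ a m) (hb0 : ∀ m, 0 ≤ b m)
  (ha : a i + a j + a k = 1) (hb : b i + b j + b k = 1)

include ha0 hb0 ha hb

/-- On the edge reached by flipping `i` first, the other order is a detour: its square is larger by
`9 a_j b_i`. Such inequalities make the minima agree on both sides of an edge. -/
theorem dev2_le_dev2 (h : b j = 0) : dev2 i j k a b ≤ dev2 j i k a b := by
  refine hexNorm_le_hexNorm ?_
  have hk : b k = 1 - b i := by linarith
  have hk' : a k = 1 - a i - a j := by linarith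
  rw [hk, hk', h]
  linarith [mul_nonneg (ha0 j) (hb0 i)]

/-- The squares differ by `9 b_j (1 - a_j)`. -/
theorem dev3_le_dev3_swap (h : b k = 0) : dev3 i j k a b ≤ dev3 i k j a b := by
  refine hexNorm_le_hexNorm ?_
  have hk : b i = 1 - b j := by linarith
  have hk' : a k = 1 - a i - a j := by linarith
  rw [hk, hk', h]
  linarith [mul_nonneg (hb0 j) (by linarith [ha0 k, ha0 i] : 0 ≤ 1 - a j)]

/-- The squares differ by `9 a_k (1 + b_j)`. -/
theorem dev3_le_dev3_rotate (h : b k = 0) : dev3 i j k a b ≤ dev3 k i j a b := by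
  refine hexNorm_le_hexNorm ?_
  have hk : b i = 1 - b j := by linarith
  have hk' : a i = 1 - a k - a j := by linarith
  rw [hk, hk', h]
  linarith [mul_nonneg (hb0 j) (ha0 k), ha0 k]

end edges

/-! ### Lipschitz bounds for the unfolded distances -/

section lipschitz

variable {i j k : Fin 3} {a b b' : Fin 3 → ℝ} {r : ℝ}

theorem hexNorm_of_sum_eq_zero {x y z : ℝ} (h : x + y + z = 0) :
    hexNorm (z - x) y = √(3 / 2 * (x ^ 2 + y ^ 2 + z ^ 2)) := by
  obtain rfl : z = -x - y := by linarith
  unfold hexNorm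
  congr 1
  ring

variable (hb : b i + b j + b k = 1) (hb' : b' i + b' j + b' k = 1)
  (hr : 3 / 2 * ((b' i - b i) ^ 2 + (b' j - b j) ^ 2 + (b' k - b k) ^ 2) = r)

include hb hb' hr

theorem dev0_le_add : dev0 i j k a b' ≤ dev0 i j k a b + √r := by
  have h := hexNorm_of_sum_eq_zero (x := b' i - b i) (y := b' j - b j) (z := b' k - b k)
    (by linarith)
  rw [← hr, ← h]
  refine le_of_eq_of_le ?_ (hexNorm_add_le _ _ _ _)
  unfold dev0
  congr 1 <;> ring

theorem dev1_le_add : dev1 i j k a b' ≤ dev1 i j k a b + √r := by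
  have h := hexNorm_of_sum_eq_zero (x := b' j - b j) (y := b' k - b k) (z := b' i - b i)
    (by linarith)
  rw [← hexNorm_neg_right] at h
  have hr' : 3 / 2 * ((b' j - b j) ^ 2 + (b' k - b k) ^ 2 + (b' i - b i) ^ 2) = r := by linarith
  rw [hr'] at h
  rw [← h]
  refine le_of_eq_of_le ?_ (hexNorm_add_le _ _ _ _)
  unfold dev1
  congr 1 <;> linarith

theorem dev2_le_add : dev2 i j k a b' ≤ dev2 i j k a b + √r := by
  have h := hexNorm_of_sum_eq_zero (x := b' k - b k) (y := b' i - b i) (z := b' j - b j)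
    (by linarith)
  have hr' : 3 / 2 * ((b' k - b k) ^ 2 + (b' i - b i) ^ 2 + (b' j - b j) ^ 2) = r := by linarith
  rw [hr'] at h
  rw [← h]
  refine le_of_eq_of_le ?_ (hexNorm_add_le _ _ _ _)
  unfold dev2
  congr 1 <;> ring

theorem dev3_le_add : dev3 i j k a b' ≤ dev3 i j k a b + √r := by
  have h := hexNorm_of_sum_eq_zero (x := b' i - b i) (y := b' j - b j) (z := b' k - b k)
    (by linarith)
  rw [← hexNorm_neg_right] at h
  rw [← hr, ← h]
  refine le_of_eq_of_le ?_ (hexNorm_add_le _ _ _ _)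
  unfold dev3
  congr 1 <;> ring

end lipschitz

/-! ### The distance from a point of the face `+++` -/

/-- The distance to the point of the opposite face with barycentric coordinates `b`. -/
def oppDist (a b : Fin 3 → ℝ) : ℝ :=
  min (min (dev3 0 1 2 a b) (dev3 1 0 2 a b))
    (min (min (dev3 0 2 1 a b) (dev3 2 0 1 a b)) (min (dev3 1 2 0 a b) (dev3 2 1 0 a b)))

/-- The distance to the point with barycentric coordinates `b` on the face with the given signs,
where `true` stands for a negative coordinate. -/
def faceDist : Bool → Bool → Bool → (Fin 3 → ℝ) → (Fin 3 → ℝ) → ℝ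
  | false, false, false, a, b => dev0 0 1 2 a b
  | true, false, false, a, b => dev1 0 1 2 a b
  | false, true, false, a, b => dev1 1 2 0 a b
  | false, false, true, a, b => dev1 2 0 1 a b
  | true, true, false, a, b => min (dev2 0 1 2 a b) (dev2 1 0 2 a b)
  | true, false, true, a, b => min (dev2 0 2 1 a b) (dev2 2 0 1 a b)
  | false, true, true, a, b => min (dev2 1 2 0 a b) (dev2 2 1 0 a b)
  | true, true, true, a, b => oppDist a b

/-! ### Continuity across edges and the Lipschitz bound for `faceDist` -/

section faceDist

variable {a b : Fin 3 → ℝ} (ha : IsBary a) (hb : IsBary b)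

include ha hb

theorem min_dev2_eq_dev1 {i j k : Fin 3} (sa : a i + a j + a k = 1) (sb : b i + b j + b k = 1)
    (h : b j = 0) : min (dev2 i j k a b) (dev2 j i k a b) = dev1 i j k a b := by
  rw [min_eq_left (dev2_le_dev2 ha.nonneg hb.nonneg sa sb h), dev2_eq_dev1 sb h]

/-- On the edge `b k = 0` the two rows that flip `k` last extend the rows of the neighbouring face,
and the four other rows are never shorter. -/
theorem min_dev3_eq_min_dev2 {i j k : Fin 3} (sa : a i + a j + a k = 1)
    (sb : b i + b j + b k = 1) (h : b k = 0) :
    min (min (dev3 i j k a b) (dev3 j i k a b))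
      (min (min (dev3 i k j a b) (dev3 k i j a b)) (min (dev3 j k i a b) (dev3 k j i a b))) =
    min (dev2 i j k a b) (dev2 j i k a b) := by
  have sa' : a j + a i + a k = 1 := by linarith
  have sb' : b j + b i + b k = 1 := by linarith
  rw [← dev3_eq_dev2 sb h, ← dev3_eq_dev2 sb' h]
  refine min_eq_left (le_min (le_min ?_ ?_) (le_min ?_ ?_))
  · exact (min_le_left _ _).trans (dev3_le_dev3_swap ha.nonneg hb.nonneg sa sb h)
  · exact (min_le_left _ _).trans (dev3_le_dev3_rotate ha.nonneg hb.nonneg sa sb h)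
  · exact (min_le_right _ _).trans (dev3_le_dev3_swap ha.nonneg hb.nonneg sa' sb' h)
  · exact (min_le_right _ _).trans (dev3_le_dev3_rotate ha.nonneg hb.nonneg sa' sb' h)

theorem faceDist_flip_two (h : b 2 = 0) (s t : Bool) :
    faceDist s t true a b = faceDist s t false a b := by
  have sa := ha.sum
  have sb := hb.sum
  rcases s with _ | _ <;> rcases t with _ | _ <;> simp only [faceDist, oppDist]
  · rw [dev1_eq_dev0 (by linarith) h, dev0_rotate (i := 1) (by linarith) (by linarith),
      dev0_rotate (i := 0) (by linarith) (by linarith)]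
  · rw [min_dev2_eq_dev1 ha hb (by linarith) (by linarith) h]
  · rw [min_dev2_eq_dev1 ha hb (by linarith) (by linarith) h,
      dev1_swap (by linarith) (by linarith)]
  · rw [min_dev3_eq_min_dev2 ha hb (by linarith) (by linarith) h]

theorem faceDist_flip_one (h : b 1 = 0) (s t : Bool) :
    faceDist s true t a b = faceDist s false t a b := by
  have sa := ha.sum
  have sb := hb.sum
  rcases s with _ | _ <;> rcases t with _ | _ <;> simp only [faceDist, oppDist]
  · rw [dev1_eq_dev0 (by linarith) h, dev0_rotate (i := 0) (by linarith) (by linarith)]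
  · rw [min_comm, min_dev2_eq_dev1 ha hb (by linarith) (by linarith) h,
      dev1_swap (by linarith) (by linarith)]
  · rw [min_dev2_eq_dev1 ha hb (by linarith) (by linarith) h]
  · rw [← min_dev3_eq_min_dev2 ha hb (by linarith) (by linarith) h, min_left_comm,
      min_comm (dev3 1 2 0 a b)]

theorem faceDist_flip_zero (h : b 0 = 0) (s t : Bool) :
    faceDist true s t a b = faceDist false s t a b := by
  have sa := ha.sum
  have sb := hb.sum
  rcases s with _ | _ <;> rcases t with _ | _ <;> simp only [faceDist, oppDist]
  · rw [dev1_eq_dev0 (by linarith) h]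
  · rw [min_comm, min_dev2_eq_dev1 ha hb (by linarith) (by linarith) h]
  · rw [min_comm, min_dev2_eq_dev1 ha hb (by linarith) (by linarith) h,
      dev1_swap (by linarith) (by linarith)]
  · rw [← min_dev3_eq_min_dev2 ha hb (by linarith) (by linarith) h, min_comm (dev3 0 1 2 a b),
      min_comm (dev3 0 2 1 a b), ← min_assoc, min_comm]

omit ha in
theorem faceDist_le_add {b' : Fin 3 → ℝ} (hb' : IsBary b') (s₀ s₁ s₂ : Bool) :
    faceDist s₀ s₁ s₂ a b' ≤ faceDist s₀ s₁ s₂ a b +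
      √(3 / 2 * ((b' 0 - b 0) ^ 2 + (b' 1 - b 1) ^ 2 + (b' 2 - b 2) ^ 2)) := by
  have sb := hb.sum
  have sb' := hb'.sum
  obtain ⟨r, hr⟩ : ∃ r, 3 / 2 * ((b' 0 - b 0) ^ 2 + (b' 1 - b 1) ^ 2 + (b' 2 - b 2) ^ 2) = r :=
    ⟨_, rfl⟩
  rw [hr]
  rcases s₀ with _ | _ <;> rcases s₁ with _ | _ <;> rcases s₂ with _ | _ <;>
    simp only [faceDist, oppDist, ← min_add_add_right]
  · exact dev0_le_add (by linarith) (by linarith) (by linarith)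
  · exact dev1_le_add (by linarith) (by linarith) (by linarith)
  · exact dev1_le_add (by linarith) (by linarith) (by linarith)
  · exact min_le_min (dev2_le_add (by linarith) (by linarith) (by linarith))
      (dev2_le_add (by linarith) (by linarith) (by linarith))
  · exact dev1_le_add (by linarith) (by linarith) (by linarith)
  · exact min_le_min (dev2_le_add (by linarith) (by linarith) (by linarith))
      (dev2_le_add (by linarith) (by linarith) (by linarith))
  · exact min_le_min (dev2_le_add (by linarith) (by linarith) (by linarith))
      (dev2_le_add (by linarith) (by linarith) (by linarith))
  · refine min_le_min (min_le_min ?_ ?_) (min_le_min (min_le_min ?_ ?_) (min_le_min ?_ ?_)) <;>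
      exact dev3_le_add (by linarith) (by linarith) (by linarith)

end faceDist

/-- The sign `s` is admissible for the coordinate `x`, where `true` stands for negative. -/
def SignOK (s : Bool) (x : ℝ) : Prop := if s then x ≤ 0 else 0 ≤ x

theorem signOK_decide (x : ℝ) : SignOK (decide (x < 0)) x := by
  by_cases h : x < 0
  · simpa [SignOK, h] using h.le
  · simpa [SignOK, h] using not_lt.1 h

theorem SignOK.eq_decide_or {s : Bool} {x : ℝ} (h : SignOK s x) : s = decide (x < 0) ∨ x = 0 := by
  rcases s with _ | _
  · left; simpa [SignOK] using h
  · rcases (show x ≤ 0 by simpa [SignOK] using h).lt_or_eq with h | h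
    · left; simpa using h
    · right; exact h

theorem exists_signOK {x y : ℝ} (h : 0 ≤ x * y) : ∃ s, SignOK s x ∧ SignOK s y := by
  rcases mul_nonneg_iff.1 h with h | h
  · exact ⟨false, by simpa [SignOK] using h⟩
  · exact ⟨true, by simpa [SignOK] using h⟩

/-- The barycentric coordinates of a point of the octahedron on its face. -/
def bary (q : octahedron) (m : Fin 3) : ℝ := |coords q m|

theorem isBary_bary (q : octahedron) : IsBary (bary q) :=
  ⟨fun _ => abs_nonneg _, sum_abs_coords q⟩

/-- The intrinsic distance from the point with barycentric coordinates `a` on the face `+++`. -/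
def surfDist (a : Fin 3 → ℝ) (q : octahedron) : ℝ :=
  faceDist (decide (coords q 0 < 0)) (decide (coords q 1 < 0)) (decide (coords q 2 < 0)) a (bary q)

/-- `surfDist` treats a zero coordinate as positive. Agreement across edges makes this choice
immaterial, so any face containing the point may be used. -/
theorem faceDist_eq_surfDist {a : Fin 3 → ℝ} (ha : IsBary a) {q : octahedron} {s₀ s₁ s₂ : Bool}
    (h0 : SignOK s₀ (coords q 0)) (h1 : SignOK s₁ (coords q 1)) (h2 : SignOK s₂ (coords q 2)) :
    faceDist s₀ s₁ s₂ a (bary q) = surfDist a q := by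
  have hq := isBary_bary q
  have e0 : ∀ s t, faceDist s₀ s t a (bary q) =
      faceDist (decide (coords q 0 < 0)) s t a (bary q) := by
    intro s t
    rcases h0.eq_decide_or with h | h
    · rw [h]
    · have h' : bary q 0 = 0 := by simp [bary, h]
      cases s₀ <;> cases decide (coords q 0 < 0) <;> simp [faceDist_flip_zero ha hq h']
  have e1 : ∀ s t, faceDist s s₁ t a (bary q) =
      faceDist s (decide (coords q 1 < 0)) t a (bary q) := by
    intro s t
    rcases h1.eq_decide_or with h | h
    · rw [h]
    · have h' : bary q 1 = 0 := by simp [bary, h]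
      cases s₁ <;> cases decide (coords q 1 < 0) <;> simp [faceDist_flip_one ha hq h']
  have e2 : ∀ s t, faceDist s t s₂ a (bary q) =
      faceDist s t (decide (coords q 2 < 0)) a (bary q) := by
    intro s t
    rcases h2.eq_decide_or with h | h
    · rw [h]
    · have h' : bary q 2 = 0 := by simp [bary, h]
      cases s₂ <;> cases decide (coords q 2 < 0) <;> simp [faceDist_flip_two ha hq h']
  rw [e0, e1, e2, surfDist]

theorem surfDist_le_add {a : Fin 3 → ℝ} (ha : IsBary a) (u v : octahedron)
    (h : ∀ m, 0 ≤ u.1 m * v.1 m) : surfDist a v ≤ surfDist a u + dist u v := by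
  have h' : ∀ m, 0 ≤ coords u m * coords v m := fun m => coords_mul_nonneg.2 (h m)
  obtain ⟨s₀, hu0, hv0⟩ := exists_signOK (h' 0)
  obtain ⟨s₁, hu1, hv1⟩ := exists_signOK (h' 1)
  obtain ⟨s₂, hu2, hv2⟩ := exists_signOK (h' 2)
  rw [← faceDist_eq_surfDist ha hu0 hu1 hu2, ← faceDist_eq_surfDist ha hv0 hv1 hv2,
    dist_eq_hexNorm 1 u v h']
  have su := sum_abs_coords u
  have sv := sum_abs_coords v
  simp only [Equiv.Perm.coe_one, id]
  rw [hexNorm_of_sum_eq_zero (by linarith)]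
  exact faceDist_le_add (isBary_bary u) (isBary_bary v) s₀ s₁ s₂

theorem exists_perm_eq (i j k : Fin 3) (hij : i ≠ j) (hjk : j ≠ k) (hik : i ≠ k) :
    ∃ σ : Equiv.Perm (Fin 3), σ 0 = i ∧ σ 1 = j ∧ σ 2 = k := by
  revert i j k
  decide

/-! ### Upper bound by explicit paths -/

section upper

variable {a : Fin 3 → ℝ} (ha : IsBary a) (p q : octahedron) (hp : coords p = a)

include ha hp

theorem intrinsicEDist_le_of_reach {L : ℝ} (h : Reach a (coords q) L) :
    intrinsicEDist p q ≤ ENNReal.ofReal L := by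
  subst hp
  obtain ⟨hu, hv, h⟩ := h
  rwa [octPoint_coords, octPoint_coords] at h

theorem intrinsicEDist_le_dev0 (h0 : 0 ≤ coords q 0) (h1 : 0 ≤ coords q 1)
    (h2 : 0 ≤ coords q 2) : intrinsicEDist p q ≤ ENNReal.ofReal (dev0 0 1 2 a (bary q)) := by
  have h := intrinsicEDist_le_of_reach ha p q hp (reach_of_mul_nonneg 1 (u := a) (v := coords q)
    (by simpa only [abs_of_nonneg (ha.nonneg _)] using ha.sum) (sum_abs_coords q) (by
      intro m
      refine mul_nonneg (ha.nonneg _) ?_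
      fin_cases m <;> assumption))
  convert h using 3
  simp only [dev0, bary, Equiv.Perm.coe_one, id, abs_of_nonneg (ha.nonneg _)]
  congr 1
  ring

theorem intrinsicEDist_le_dev1 (i j k : Fin 3) (hij : i ≠ j) (hjk : j ≠ k) (hik : i ≠ k)
    (h0 : coords q i ≤ 0) (h1 : 0 ≤ coords q j) (h2 : 0 ≤ coords q k) :
    intrinsicEDist p q ≤ ENNReal.ofReal (dev1 i j k a (bary q)) := by
  obtain ⟨σ, rfl, rfl, rfl⟩ := exists_perm_eq i j k hij hjk hik
  have h := intrinsicEDist_le_of_reach ha p q hp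
    (reach_two_faces σ ha.nonneg ha.sum (sum_abs_coords q) h0 h1 h2)
  simpa only [dev1, bary, abs_of_nonpos h0, abs_of_nonneg h1, abs_of_nonneg h2,
    ← sub_eq_add_neg] using h

theorem intrinsicEDist_le_dev2 (i j k : Fin 3) (hij : i ≠ j) (hjk : j ≠ k) (hik : i ≠ k)
    (h0 : coords q i ≤ 0) (h1 : coords q j ≤ 0) (h2 : 0 ≤ coords q k) :
    intrinsicEDist p q ≤ ENNReal.ofReal (dev2 i j k a (bary q)) := by
  obtain ⟨σ, rfl, rfl, rfl⟩ := exists_perm_eq i j k hij hjk hik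
  have h := intrinsicEDist_le_of_reach ha p q hp
    (reach_three_faces σ ha.nonneg ha.sum (sum_abs_coords q) h0 h1 h2)
  simpa only [dev2, bary, abs_of_nonpos h0, abs_of_nonpos h1, abs_of_nonneg h2,
    ← sub_eq_add_neg] using h

theorem intrinsicEDist_le_dev3 (i j k : Fin 3) (hij : i ≠ j) (hjk : j ≠ k) (hik : i ≠ k)
    (h0 : coords q i ≤ 0) (h1 : coords q j ≤ 0) (h2 : coords q k ≤ 0) :
    intrinsicEDist p q ≤ ENNReal.ofReal (dev3 i j k a (bary q)) := by
  obtain ⟨σ, rfl, rfl, rfl⟩ := exists_perm_eq i j k hij hjk hik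
  have h := intrinsicEDist_le_of_reach ha p q hp
    (reach_four_faces σ ha.nonneg ha.sum (sum_abs_coords q) h0 h1 h2)
  simpa only [dev3, bary, abs_of_nonpos h0, abs_of_nonpos h1, abs_of_nonpos h2,
    ← sub_eq_add_neg, sub_neg_eq_add] using h

omit ha hp in
theorem le_ofReal_min {x : ENNReal} {y z : ℝ} (hy : x ≤ ENNReal.ofReal y)
    (hz : x ≤ ENNReal.ofReal z) : x ≤ ENNReal.ofReal (min y z) := by
  rcases min_choice y z with h | h <;> rwa [h]

theorem intrinsicEDist_le_surfDist : intrinsicEDist p q ≤ ENNReal.ofReal (surfDist a q) := by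
  have k0 := signOK_decide (coords q 0)
  have k1 := signOK_decide (coords q 1)
  have k2 := signOK_decide (coords q 2)
  unfold surfDist
  generalize decide (coords q 0 < 0) = s₀ at *
  generalize decide (coords q 1 < 0) = s₁ at *
  generalize decide (coords q 2 < 0) = s₂ at *
  have e1 := intrinsicEDist_le_dev1 ha p q hp
  have e2 := intrinsicEDist_le_dev2 ha p q hp
  have e3 := intrinsicEDist_le_dev3 ha p q hp
  rcases s₀ with _ | _ <;> rcases s₁ with _ | _ <;> rcases s₂ with _ | _ <;>
    simp only [SignOK, if_true, if_false, Bool.false_eq_true] at k0 k1 k2 <;>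
    simp only [faceDist, oppDist]
  · exact intrinsicEDist_le_dev0 ha p q hp k0 k1 k2
  · exact e1 2 0 1 (by decide) (by decide) (by decide) k2 k0 k1
  · exact e1 1 2 0 (by decide) (by decide) (by decide) k1 k2 k0
  · exact le_ofReal_min (e2 1 2 0 (by decide) (by decide) (by decide) k1 k2 k0)
      (e2 2 1 0 (by decide) (by decide) (by decide) k2 k1 k0)
  · exact e1 0 1 2 (by decide) (by decide) (by decide) k0 k1 k2
  · exact le_ofReal_min (e2 0 2 1 (by decide) (by decide) (by decide) k0 k2 k1)
      (e2 2 0 1 (by decide) (by decide) (by decide) k2 k0 k1)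
  · exact le_ofReal_min (e2 0 1 2 (by decide) (by decide) (by decide) k0 k1 k2)
      (e2 1 0 2 (by decide) (by decide) (by decide) k1 k0 k2)
  · refine le_ofReal_min (le_ofReal_min ?_ ?_) (le_ofReal_min (le_ofReal_min ?_ ?_)
      (le_ofReal_min ?_ ?_)) <;>
      exact e3 _ _ _ (by decide) (by decide) (by decide) (by assumption) (by assumption)
        (by assumption)

/-- The intrinsic distance from a point of the face `+++` is the shortest unfolded distance. -/
theorem intrinsicEDist_eq_surfDist : intrinsicEDist p q = ENNReal.ofReal (surfDist a q) := by
  refine le_antisymm (intrinsicEDist_le_surfDist ha p q hp) ?_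
  have h := ofReal_sub_le_intrinsicEDist (surfDist a) (surfDist_le_add ha) p q
  have hb : bary p = a := by
    ext m
    rw [bary, hp, abs_of_nonneg (ha.nonneg m)]
  have h0 : surfDist a p = 0 := by
    rw [← faceDist_eq_surfDist ha (s₀ := false) (s₁ := false) (s₂ := false)
      (by simpa [SignOK, hp] using ha.nonneg 0) (by simpa [SignOK, hp] using ha.nonneg 1)
      (by simpa [SignOK, hp] using ha.nonneg 2), hb]
    simp [faceDist, dev0, hexNorm]
  rwa [h0, sub_zero] at h

end upper

theorem surfDist_nonneg (a : Fin 3 → ℝ) (q : octahedron) : 0 ≤ surfDist a q := by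
  unfold surfDist
  generalize decide (coords q 0 < 0) = s₀
  generalize decide (coords q 1 < 0) = s₁
  generalize decide (coords q 2 < 0) = s₂
  rcases s₀ with _ | _ <;> rcases s₁ with _ | _ <;> rcases s₂ with _ | _ <;>
    simp only [faceDist, oppDist, le_min_iff, dev0, dev1, dev2, dev3, hexNorm_nonneg, and_self]

/-- The farthest points are the maximizers of the unfolded distance. -/
theorem mem_farthestSet_iff {a : Fin 3 → ℝ} (ha : IsBary a) {p : octahedron} (hp : coords p = a)
    (q : octahedron) : q ∈ farthestSet p ↔ ∀ r, surfDist a r ≤ surfDist a q := by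
  simp only [farthestSet, mem_ofPred_eq, intrinsicEDist_eq_surfDist ha _ _ hp,
    ENNReal.ofReal_le_ofReal_iff (surfDist_nonneg _ _)]

/-! ### Points off the opposite face are not farthest -/

theorem sum_of_ne (i j k : Fin 3) (hij : i ≠ j) (hjk : j ≠ k) (hik : i ≠ k) (f : Fin 3 → ℝ) :
    f i + f j + f k = f 0 + f 1 + f 2 := by
  obtain ⟨σ, rfl, rfl, rfl⟩ := exists_perm_eq i j k hij hjk hik
  exact sum_perm σ f

theorem hexNorm_le_sqrt {u v R : ℝ} (h : 3 / 4 * u ^ 2 + 9 / 4 * v ^ 2 ≤ R) :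
    hexNorm u v ≤ √R :=
  Real.sqrt_le_sqrt h

theorem isBary_single (i : Fin 3) : IsBary (Pi.single i 1) := by
  refine ⟨fun m => ?_, ?_⟩
  · rcases eq_or_ne m i with rfl | hm <;> simp [*]
  · fin_cases i <;> simp

section offOpposite

variable {a b : Fin 3 → ℝ} (ha : IsBary a) (hb : IsBary b) {R : ℝ} (hR : 3 < R)

include ha hb hR

theorem dev0_lt : dev0 0 1 2 a b < √R := by
  refine (hexNorm_le_sqrt (R := 3) ?_).trans_lt (Real.sqrt_lt_sqrt (by norm_num) hR)
  have a0 := ha.nonneg 0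
  have a1 := ha.nonneg 1
  have a2 := ha.nonneg 2
  have b0 := hb.nonneg 0
  have b1 := hb.nonneg 1
  have b2 := hb.nonneg 2
  have sa : a 1 = 1 - a 0 - a 2 := by linarith [ha.sum]
  have sb : b 1 = 1 - b 0 - b 2 := by linarith [hb.sum]
  rw [sa] at a1
  rw [sb] at b1
  rw [sa, sb]
  have h1 : a 0 ^ 2 + a 2 ^ 2 + (1 - a 0 - a 2) ^ 2 ≤ 1 := by nlinarith [mul_nonneg a0 a2]
  have h2 : b 0 ^ 2 + b 2 ^ 2 + (1 - b 0 - b 2) ^ 2 ≤ 1 := by nlinarith [mul_nonneg b0 b2]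
  have h3 := mul_nonneg a0 b0
  have h4 := mul_nonneg a2 b2
  have h5 := mul_nonneg a1 b1
  linarith

/-- By convexity of the norm the distance is at most the average of its values at the three
vertices. Two of these belong to the starting face and contribute at most `√3 < √R`, with positive
weight because `b i < 1`. -/
theorem dev1_lt {i j k : Fin 3} (hij : i ≠ j) (hjk : j ≠ k) (hik : i ≠ k)
    (h : dev1 i j k a (Pi.single i 1) ≤ √R) (hbi : b i < 1) : dev1 i j k a b < √R := by
  have sa := (sum_of_ne i j k hij hjk hik a).trans ha.sum
  have sb := (sum_of_ne i j k hij hjk hik b).trans hb.sum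
  have ai := ha.nonneg i
  have aj := ha.nonneg j
  have ak := ha.nonneg k
  simp only [dev1, Pi.single_eq_same, Pi.single_eq_of_ne hij.symm] at h
  have hj : hexNorm (a i - a k) (1 - a j) ≤ √3 := by
    refine hexNorm_le_sqrt ?_
    have : a j = 1 - a i - a k := by linarith
    rw [this]
    nlinarith [mul_nonneg ai ak]
  have hk : hexNorm (1 + a i - a k) (-a j) ≤ √3 := by
    refine hexNorm_le_sqrt ?_
    have : a k = 1 - a i - a j := by linarith
    rw [this]
    nlinarith [mul_nonneg ai aj]
  have h3 : √3 < √R := Real.sqrt_lt_sqrt (by norm_num) hR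
  have key : dev1 i j k a b ≤ b i * √R + (b j * √3 + b k * √3) := by
    have e : dev1 i j k a b = hexNorm
        (b i * (1 + 1 - 0 + a i - a k) + (b j * (a i - a k) + b k * (1 + a i - a k)))
        (b i * (1 + 0 - a j) + (b j * (1 - a j) + b k * (-a j))) := by
      have : b k = 1 - b i - b j := by linarith
      unfold dev1
      rw [this]
      congr 1 <;> ring
    rw [e]
    refine (hexNorm_add_le _ _ _ _).trans (add_le_add ?_ ((hexNorm_add_le _ _ _ _).trans
      (add_le_add ?_ ?_)))
    · rw [hexNorm_mul (hb.nonneg i)]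
      exact mul_le_mul_of_nonneg_left h (hb.nonneg i)
    · rw [hexNorm_mul (hb.nonneg j)]
      exact mul_le_mul_of_nonneg_left hj (hb.nonneg j)
    · rw [hexNorm_mul (hb.nonneg k)]
      exact mul_le_mul_of_nonneg_left hk (hb.nonneg k)
  have : b j * √3 + b k * √3 = (1 - b i) * √3 := by rw [← add_mul]; congr 1; linarith
  nlinarith

omit hb in
-- Convexity along the segment from vertex `k`, which lies on the starting face and so is at
-- distance at most `√3`, to the edge point `b'`.
theorem dev2_lt_of_le {i j k : Fin 3} (hij : i ≠ j) (hjk : j ≠ k) (hik : i ≠ k)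
    {b' : Fin 3 → ℝ} {θ : ℝ} (hθ0 : 0 ≤ θ) (hθ1 : θ < 1) (hi : b i = θ * b' i)
    (hj : b j = θ * b' j) (hk : b k = 1 - θ) (hk' : b' k = 0)
    (h : dev2 i j k a b' ≤ √R) : dev2 i j k a b < √R := by
  have sa := (sum_of_ne i j k hij hjk hik a).trans ha.sum
  have ai := ha.nonneg i
  have aj := ha.nonneg j
  have h0 : hexNorm (1 + a i - a k) (-a j) ≤ √3 := by
    refine hexNorm_le_sqrt ?_
    have : a k = 1 - a i - a j := by linarith
    rw [this]
    nlinarith [mul_nonneg ai aj, ha.nonneg k]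
  have h3 : √3 < √R := Real.sqrt_lt_sqrt (by norm_num) hR
  have key : dev2 i j k a b ≤ θ * √R + (1 - θ) * √3 := by
    have e : dev2 i j k a b = hexNorm
        (θ * (2 + b' j - b' k + a i - a k) + (1 - θ) * (1 + a i - a k))
        (θ * (b' i - a j) + (1 - θ) * (-a j)) := by
      unfold dev2
      rw [hi, hj, hk, hk']
      congr 1 <;> ring
    rw [e]
    refine (hexNorm_add_le _ _ _ _).trans (add_le_add ?_ ?_)
    · rw [hexNorm_mul hθ0]
      exact mul_le_mul_of_nonneg_left h hθ0
    · rw [hexNorm_mul (by linarith)]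
      exact mul_le_mul_of_nonneg_left h0 (by linarith)
  nlinarith

theorem min_dev2_lt {i j k : Fin 3} (hij : i ≠ j) (hjk : j ≠ k) (hik : i ≠ k)
    (h : ∀ b', IsBary b' → b' k = 0 → min (dev2 i j k a b') (dev2 j i k a b') ≤ √R)
    (hbk : 0 < b k) : min (dev2 i j k a b) (dev2 j i k a b) < √R := by
  have sb := (sum_of_ne i j k hij hjk hik b).trans hb.sum
  -- `b'` is the projection of `b` from vertex `k` to the opposite edge. If `b` is that vertex, any
  -- point of the edge works, and vertex `i` is taken.
  obtain ⟨b', hb', hk', hi, hj⟩ : ∃ b', IsBary b' ∧ b' k = 0 ∧ b i = (1 - b k) * b' i ∧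
      b j = (1 - b k) * b' j := by
    rcases (show 0 ≤ 1 - b k by linarith [hb.nonneg i, hb.nonneg j]).eq_or_lt with h0 | h0
    · refine ⟨Pi.single i 1, isBary_single i, by simp [hik], ?_, ?_⟩
      · rw [← h0]; linarith [hb.nonneg i, hb.nonneg j]
      · rw [← h0]; linarith [hb.nonneg i, hb.nonneg j]
    · refine ⟨fun m => if m = k then 0 else b m / (1 - b k), ⟨fun m => ?_, ?_⟩, by simp, ?_, ?_⟩
      · rcases eq_or_ne m k with rfl | hm
        · simp
        · simpa [hm] using div_nonneg (hb.nonneg m) h0.le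
      · refine (sum_of_ne i j k hij hjk hik
          fun m => if m = k then 0 else b m / (1 - b k)).symm.trans ?_
        simp only [hik, hjk, if_true, if_false, add_zero]
        rw [← add_div, div_eq_one_iff_eq h0.ne']
        linarith
      · simp only [hik, if_false]
        exact (mul_div_cancel₀ _ h0.ne').symm
      · simp only [hjk, if_false]
        exact (mul_div_cancel₀ _ h0.ne').symm
  have hθ : 0 ≤ 1 - b k := by linarith [hb.nonneg i, hb.nonneg j]
  rcases min_le_iff.1 (h b' hb' hk') with h | h
  · exact min_lt_of_left_lt (dev2_lt_of_le ha hR hij hjk hik hθ (by linarith) hi hj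
      (by ring) hk' h)
  · exact min_lt_of_right_lt (dev2_lt_of_le ha hR hij.symm hik hjk hθ (by linarith) hj hi
      (by ring) hk' h)

end offOpposite

/-- A bound for the distance on the opposite face is strict on the rest of the surface. -/
theorem surfDist_lt {a : Fin 3 → ℝ} (ha : IsBary a) {R : ℝ} (hR : 3 < R)
    (h : ∀ b, IsBary b → oppDist a b ≤ √R) (q : octahedron) (hq : ∃ m, 0 < coords q m) :
    surfDist a q < √R := by
  have hb := isBary_bary q
  have key : ∀ x : ℝ, ∃ s, SignOK s x ∧ (s = false → 0 < |x|) ∧ (0 < x → s = false) := by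
    intro x
    rcases le_or_gt x 0 with hx | hx
    · exact ⟨true, by simpa [SignOK] using hx, by simp, fun h => absurd h (not_lt.2 hx)⟩
    · exact ⟨false, by simpa [SignOK] using hx.le, fun _ => abs_pos.2 hx.ne', fun _ => rfl⟩
  obtain ⟨s₀, k0, p0, n0⟩ := key (coords q 0)
  obtain ⟨s₁, k1, p1, n1⟩ := key (coords q 1)
  obtain ⟨s₂, k2, p2, n2⟩ := key (coords q 2)
  rw [← faceDist_eq_surfDist ha k0 k1 k2]
  change s₀ = false → 0 < bary q 0 at p0
  change s₁ = false → 0 < bary q 1 at p1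
  change s₂ = false → 0 < bary q 2 at p2
  have hne : ¬(s₀ = true ∧ s₁ = true ∧ s₂ = true) := by
    rintro ⟨rfl, rfl, rfl⟩
    obtain ⟨m, hm⟩ := hq
    fin_cases m
    · exact absurd (n0 hm) (by simp)
    · exact absurd (n1 hm) (by simp)
    · exact absurd (n2 hm) (by simp)
  have f0 := fun b hb => faceDist_flip_zero (b := b) ha hb
  have f1 := fun b hb => faceDist_flip_one (b := b) ha hb
  have f2 := fun b hb => faceDist_flip_two (b := b) ha hb
  have hbs := hb.sum
  have b0 := hb.nonneg 0
  have b1 := hb.nonneg 1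
  have b2 := hb.nonneg 2
  rcases s₀ with _ | _ <;> rcases s₁ with _ | _ <;> rcases s₂ with _ | _
  · exact dev0_lt ha hb hR
  · refine dev1_lt ha hb hR (by decide) (by decide) (by decide) ?_ (by linarith [p0 rfl])
    change faceDist false false true a _ ≤ _
    -- The flipped vertex also lies on the opposite face: both signs at its zero coordinates may be
    -- changed.
    rw [← f1 _ (isBary_single 2) (by simp), ← f0 _ (isBary_single 2) (by simp)]
    exact h _ (isBary_single 2)
  · refine dev1_lt ha hb hR (by decide) (by decide) (by decide) ?_ (by linarith [p0 rfl])
    change faceDist false true false a _ ≤ _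
    rw [← f2 _ (isBary_single 1) (by simp), ← f0 _ (isBary_single 1) (by simp)]
    exact h _ (isBary_single 1)
  · refine min_dev2_lt ha hb hR (by decide) (by decide) (by decide) (fun b' hb' h0 => ?_) (p0 rfl)
    change faceDist false true true a _ ≤ _
    rw [← f0 _ hb' h0]
    exact h _ hb'
  · refine dev1_lt ha hb hR (by decide) (by decide) (by decide) ?_ (by linarith [p1 rfl])
    change faceDist true false false a _ ≤ _
    rw [← f2 _ (isBary_single 0) (by simp), ← f1 _ (isBary_single 0) (by simp)]
    exact h _ (isBary_single 0)
  · refine min_dev2_lt ha hb hR (by decide) (by decide) (by decide) (fun b' hb' h0 => ?_) (p1 rfl)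
    change faceDist true false true a _ ≤ _
    rw [← f1 _ hb' h0]
    exact h _ hb'
  · refine min_dev2_lt ha hb hR (by decide) (by decide) (by decide) (fun b' hb' h0 => ?_) (p2 rfl)
    change faceDist true true false a _ ≤ _
    rw [← f2 _ hb' h0]
    exact h _ hb'
  · exact absurd ⟨rfl, rfl, rfl⟩ hne

/-! ### The farthest points on the opposite face -/

/-- Barycentric coordinates of the point `x + i Y / √3` of the plane. -/
def planeBary (x Y : ℝ) : Fin 3 → ℝ := ![(1 + 2 * x) / 3, (1 - x + Y) / 3, (1 - x - Y) / 3]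

theorem planeBary_injective {x Y s W : ℝ} (h : planeBary x Y = planeBary s W) :
    x = s ∧ Y = W := by
  have h0 := congrFun h 0
  have h1 := congrFun h 1
  simp only [planeBary, Matrix.cons_val_zero, Matrix.cons_val_one] at h0 h1
  constructor <;> linarith

theorem exists_planeBary {b : Fin 3 → ℝ} (hb : IsBary b) :
    ∃ s W, b = planeBary s W ∧ -1 / 2 ≤ s ∧ W ≤ 1 - s ∧ -W ≤ 1 - s := by
  have h := hb.sum
  have h0 := hb.nonneg 0
  have h1 := hb.nonneg 1
  have h2 := hb.nonneg 2
  refine ⟨(3 * b 0 - 1) / 2, 3 / 2 * (b 1 - b 2), ?_, by linarith, by linarith, by linarith⟩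
  ext m
  fin_cases m
  · simp [planeBary]; ring
  · simp [planeBary]; linarith
  · simp [planeBary]; linarith

theorem isBary_planeBary {s W : ℝ} (h0 : -1 / 2 ≤ s) (h1 : W ≤ 1 - s) (h2 : -W ≤ 1 - s) :
    IsBary (planeBary s W) := by
  refine ⟨fun m => ?_, ?_⟩
  · fin_cases m
    · simp [planeBary]; linarith
    · simp [planeBary]; linarith
    · simp [planeBary]; linarith
  · simp [planeBary]; ring

/-! ### The six unfoldings of the opposite face in plane coordinates -/

section formulas

variable (x Y s W : ℝ)

theorem dev3_upper : dev3 1 0 2 (planeBary x Y) (planeBary s W) =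
    √(27 / 4 - 3 * (W - Y) + (W - Y) ^ 2 / 3 + (1 / 2 - x - s) ^ 2) := by
  simp only [dev3, hexNorm, planeBary, Matrix.cons_val_zero, Matrix.cons_val_one, Matrix.cons_val]
  congr 1; ring

theorem dev3_lower : dev3 2 0 1 (planeBary x Y) (planeBary s W) =
    √(27 / 4 + 3 * (W - Y) + (W - Y) ^ 2 / 3 + (1 / 2 - x - s) ^ 2) := by
  simp only [dev3, hexNorm, planeBary, Matrix.cons_val_zero, Matrix.cons_val_one, Matrix.cons_val]
  congr 1; ring

theorem dev3_left : dev3 2 1 0 (planeBary x Y) (planeBary s W) =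
    √(3 / 4 * (3 + s - x + (W - Y) / 3) ^ 2 + 1 / 4 * (1 + s + x - W - Y) ^ 2) := by
  simp only [dev3, hexNorm, planeBary, Matrix.cons_val_zero, Matrix.cons_val_one, Matrix.cons_val]
  congr 1; ring

theorem dev3_right : dev3 0 1 2 (planeBary x Y) (planeBary s W) =
    √(3 / 4 * (3 - s + x - (W - Y) / 3) ^ 2 + 1 / 4 * (1 + s + x - W - Y) ^ 2) := by
  simp only [dev3, hexNorm, planeBary, Matrix.cons_val_zero, Matrix.cons_val_one, Matrix.cons_val]
  congr 1; ring

theorem dev3_left' : dev3 1 2 0 (planeBary x Y) (planeBary s W) =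
    √(3 / 4 * (3 + s - x - (W - Y) / 3) ^ 2 + 1 / 4 * (1 + s + x + W + Y) ^ 2) := by
  simp only [dev3, hexNorm, planeBary, Matrix.cons_val_zero, Matrix.cons_val_one, Matrix.cons_val]
  congr 1; ring

theorem dev3_right' : dev3 0 2 1 (planeBary x Y) (planeBary s W) =
    √(3 / 4 * (3 - s + x + (W - Y) / 3) ^ 2 + 1 / 4 * (1 + s + x + W + Y) ^ 2) := by
  simp only [dev3, hexNorm, planeBary, Matrix.cons_val_zero, Matrix.cons_val_one, Matrix.cons_val]
  congr 1; ring

end formulas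

/-- The real part of the left candidate. -/
def leftX (x Y : ℝ) : ℝ := (3 * x + Y + x * Y - Y ^ 2) / (6 - 3 * x - Y)

/-- The real part of the right candidate. -/
def rightX (x Y : ℝ) : ℝ := (6 * x - x * Y + Y ^ 2 - Y) / (3 * x + Y + 3)

theorem const_mul_le {c t A : ℝ} (ht : 0 ≤ t) (h : c ≤ A) : c * t ≤ t * A := by
  rw [mul_comm c]
  exact mul_le_mul_of_nonneg_left h ht

theorem mul_le_const {c t A : ℝ} (ht : 0 ≤ t) (h : A ≤ c) : t * A ≤ c * t := by
  rw [mul_comm c]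
  exact mul_le_mul_of_nonneg_left h ht

/-! ### The two candidates and their maximality -/

section candidates

variable {x Y : ℝ} (hY : 0 ≤ Y) (hx : Y ≤ 3 * x) (h1 : Y ≤ 1 - x)

include hY hx h1

omit hx in
-- On `W = Y` this equation in `s = leftX x Y` says that the left unfolding ties with the upper and
-- lower ones.
theorem leftX_mul : leftX x Y * (6 - 3 * x - Y) = 3 * x + Y + x * Y - Y ^ 2 :=
  div_mul_cancel₀ _ (by linarith)

omit h1 in
-- The corresponding tie of the right unfolding with the upper and lower ones.
theorem rightX_mul : rightX x Y * (3 * x + Y + 3) = 6 * x - x * Y + Y ^ 2 - Y :=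
  div_mul_cancel₀ _ (by linarith)

theorem leftX_nonneg : 0 ≤ leftX x Y := by
  refine div_nonneg ?_ (by linarith)
  nlinarith

/-- Both `x - leftX` and `rightX - x` have numerator `(3x - Y)(1 - x - Y)`, so the candidates merge
with `x` on two sides of `T`. -/
theorem leftX_le : leftX x Y ≤ x := by
  rw [leftX, div_le_iff₀ (by linarith)]
  linarith [mul_nonneg (sub_nonneg.2 hx) (sub_nonneg.2 h1)]

theorem le_rightX : x ≤ rightX x Y := by
  rw [rightX, le_div_iff₀ (by linarith)]
  linarith [mul_nonneg (sub_nonneg.2 hx) (sub_nonneg.2 h1)]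

theorem rightX_le : rightX x Y ≤ 1 - Y := by
  rw [rightX, div_le_iff₀ (by linarith)]
  linarith [mul_nonneg (sub_nonneg.2 h1) (by linarith : 0 ≤ 3 + 2 * Y)]

theorem oppDist_leftX : oppDist (planeBary x Y) (planeBary (leftX x Y) Y) =
    √(27 / 4 + (1 / 2 - x - leftX x Y) ^ 2) := by
  have hs := leftX_mul hY h1
  have h0 := leftX_nonneg hY hx h1
  have hsx := leftX_le hY hx h1
  generalize leftX x Y = s at *
  have hp : 0 ≤ Y * (1 + s + x) := mul_nonneg hY (by linarith)
  rw [oppDist, dev3_upper, dev3_lower, dev3_left, dev3_right, dev3_left', dev3_right']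
  apply le_antisymm
  · refine (min_le_left _ _).trans ((min_le_right _ _).trans (Real.sqrt_le_sqrt ?_))
    linarith
  · refine le_min (le_min ?_ ?_) (le_min (le_min ?_ ?_) (le_min ?_ ?_)) <;>
      apply Real.sqrt_le_sqrt <;> linarith

theorem oppDist_rightX : oppDist (planeBary x Y) (planeBary (rightX x Y) Y) =
    √(27 / 4 + (1 / 2 - x - rightX x Y) ^ 2) := by
  have hs := rightX_mul hY hx
  have hsx := le_rightX hY hx h1
  generalize rightX x Y = s at *
  have hp : 0 ≤ Y * (1 + s + x) := mul_nonneg hY (by linarith)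
  rw [oppDist, dev3_upper, dev3_lower, dev3_left, dev3_right, dev3_left', dev3_right']
  apply le_antisymm
  · refine (min_le_left _ _).trans ((min_le_right _ _).trans (Real.sqrt_le_sqrt ?_))
    linarith
  · refine le_min (le_min ?_ ?_) (le_min (le_min ?_ ?_) (le_min ?_ ?_)) <;>
      apply Real.sqrt_le_sqrt <;> linarith

/-- The candidate is the strict maximum, over this part of the face, of the minimum of the three
tied unfoldings: if none were shorter, the horizontal and vertical offsets would bound each other
too tightly to be nonzero. -/
theorem exists_dev3_lt_left {s W : ℝ} (hs0 : -1 / 2 ≤ s) (hW1 : W ≤ 1 - s) (hW2 : -W ≤ 1 - s)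
    (hs : s ≤ leftX x Y) (hne : ¬(s = leftX x Y ∧ W = Y)) :
    27 / 4 - 3 * (W - Y) + (W - Y) ^ 2 / 3 + (1 / 2 - x - s) ^ 2 <
        27 / 4 + (1 / 2 - x - leftX x Y) ^ 2 ∨
      27 / 4 + 3 * (W - Y) + (W - Y) ^ 2 / 3 + (1 / 2 - x - s) ^ 2 <
        27 / 4 + (1 / 2 - x - leftX x Y) ^ 2 ∨
      3 / 4 * (3 + s - x + (W - Y) / 3) ^ 2 + 1 / 4 * (1 + s + x - W - Y) ^ 2 <
        27 / 4 + (1 / 2 - x - leftX x Y) ^ 2 := by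
  have hm := leftX_mul hY h1
  have h0 := leftX_nonneg hY hx h1
  have hsx := leftX_le hY hx h1
  generalize leftX x Y = l at *
  by_contra! hcon
  obtain ⟨c1, c2, c3⟩ := hcon
  obtain ⟨E, rfl⟩ : ∃ E, s = l - E := ⟨l - s, by ring⟩
  have hE : 0 ≤ E := by linarith
  have c3' : E * (5 + 2 * l - x - Y - E) ≤ (W - Y) * ((W - Y) / 3 + 1 - x + Y) := by linarith
  -- The constant comes from `E ≤ l + 1/2` and `x + Y ≤ 1`. Below, `3.5 E ≤ 2.25 w` with `2.5 w ≤
  -- 1.5 E`, or `3.5 E ≤ 0.75 v` with `2.25 v ≤ 1.5 E`, leaves only zero.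
  have hA : 3.5 * E ≤ E * (5 + 2 * l - x - Y - E) := const_mul_le hE (by linarith)
  rcases le_total Y W with h | h
  · obtain ⟨w, rfl⟩ : ∃ w, W = Y + w := ⟨W - Y, by ring⟩
    have hw : 0 ≤ w := by linarith
    rw [add_sub_cancel_left] at c3'
    have c1' : w * (3 - w / 3) ≤ E * (1 - 2 * x - 2 * l + E) := by linarith
    have h2 : 2.5 * w ≤ w * (3 - w / 3) := const_mul_le hw (by linarith)
    have h3 : E * (1 - 2 * x - 2 * l + E) ≤ 1.5 * E := mul_le_const hE (by linarith)
    have h4 : w * (w / 3 + 1 - x + Y) ≤ 2.25 * w := mul_le_const hw (by linarith)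
    have hE0 : E = 0 := by linarith
    have hw0 : w = 0 := by linarith
    exact hne ⟨by linarith, by linarith⟩
  · obtain ⟨v, rfl⟩ : ∃ v, W = Y - v := ⟨Y - W, by ring⟩
    have hv : 0 ≤ v := by linarith
    have c2' : v * (3 - v / 3) ≤ E * (1 - 2 * x - 2 * l + E) := by linarith
    have h2 : 2.25 * v ≤ v * (3 - v / 3) := const_mul_le hv (by linarith)
    have h3 : E * (1 - 2 * x - 2 * l + E) ≤ 1.5 * E := mul_le_const hE (by linarith)
    have h4 : v * (v / 3 - 1 + x - Y) ≤ 0.75 * v := mul_le_const hv (by linarith)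
    have hE0 : E = 0 := by linarith
    have hw0 : v = 0 := by linarith
    exact hne ⟨by linarith, by linarith⟩

theorem exists_dev3_lt_right {s W : ℝ} (hW1 : W ≤ 1 - s) (hW2 : -W ≤ 1 - s)
    (hs : rightX x Y ≤ s) (hne : ¬(s = rightX x Y ∧ W = Y)) :
    27 / 4 - 3 * (W - Y) + (W - Y) ^ 2 / 3 + (1 / 2 - x - s) ^ 2 <
        27 / 4 + (1 / 2 - x - rightX x Y) ^ 2 ∨
      27 / 4 + 3 * (W - Y) + (W - Y) ^ 2 / 3 + (1 / 2 - x - s) ^ 2 <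
        27 / 4 + (1 / 2 - x - rightX x Y) ^ 2 ∨
      3 / 4 * (3 - s + x - (W - Y) / 3) ^ 2 + 1 / 4 * (1 + s + x - W - Y) ^ 2 <
        27 / 4 + (1 / 2 - x - rightX x Y) ^ 2 := by
  have hm := rightX_mul hY hx
  have hsx := le_rightX hY hx h1
  generalize rightX x Y = l at *
  by_contra! hcon
  obtain ⟨c1, c2, c3⟩ := hcon
  obtain ⟨e, rfl⟩ : ∃ e, s = l + e := ⟨s - l, by ring⟩
  have he : 0 ≤ e := by linarith
  have hl1 : l + e ≤ 1 := by linarith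
  rcases le_total Y W with h | h
  · obtain ⟨w, rfl⟩ : ∃ w, W = Y + w := ⟨W - Y, by ring⟩
    have hw : 0 ≤ w := by linarith
    have c3' : e * (4 - 2 * l + x + Y - e) + w * (2 + x - Y) ≤ w * (w / 3) := by linarith
    have h2 : 2 * e ≤ e * (4 - 2 * l + x + Y - e) := const_mul_le he (by linarith)
    have h3 : w * (w / 3) ≤ 0.5 * w := mul_le_const hw (by linarith)
    have h4 : 1 * w ≤ w * (2 + x - Y) := const_mul_le hw (by linarith)
    have hE0 : e = 0 := by linarith
    have hw0 : w = 0 := by linarith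
    exact hne ⟨by linarith, by linarith⟩
  · obtain ⟨v, rfl⟩ : ∃ v, W = Y - v := ⟨Y - W, by ring⟩
    have hv : 0 ≤ v := by linarith
    have hv1 : v ≤ Y + 1 - l - e := by linarith
    have c2' : v * (3 - v / 3) ≤ e * (2 * l + e + 2 * x - 1) := by linarith
    have c3' : e * (4 - 2 * l + x + Y - e) ≤ v * (v / 3 + 2 + x - Y) := by linarith
    -- Constant bounds are too weak here, so `e` as a factor is eliminated by multiplying `c2'` and
    -- `c3'` crosswise; then `v` can be cancelled.
    have hF : v * ((3 - v / 3) * (4 - 2 * l + x + Y - e)) ≤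
        v * ((2 * l + e + 2 * x - 1) * (v / 3 + 2 + x - Y)) := by
      have hc : 0 ≤ 4 - 2 * l + x + Y - e := by linarith
      rcases le_total 0 (2 * l + e + 2 * x - 1) with hp | hp
      · linarith [mul_le_mul_of_nonneg_right c2' hc, mul_le_mul_of_nonneg_left c3' hp]
      · have h5 : v * (3 - v / 3) ≤ 0 := c2'.trans (mul_nonpos_of_nonneg_of_nonpos he hp)
        have h6 : 2 * v ≤ v * (3 - v / 3) := const_mul_le hv (by linarith)
        have hv0 : v = 0 := by linarith
        simp [hv0]
    have hpos : 2 * ((1 - x) * (2 + x)) + Y * (3 + x - Y / 3) ≤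
        (3 - v / 3) * (4 - 2 * l + x + Y - e) -
          (2 * l + e + 2 * x - 1) * (v / 3 + 2 + x - Y) := by
      have k1 := mul_nonneg (by linarith : 0 ≤ 1 - l) (by linarith : 0 ≤ 5 + x - Y)
      have k2 := mul_nonneg (by linarith : 0 ≤ 1 - l - e) (by linarith : 0 ≤ 4 - 4 / 3 * Y)
      have k3 := mul_nonneg (by linarith : 0 ≤ Y + 1 - l - e - v) (by linarith : 0 ≤ 3 + 3 * x + Y)
      linarith
    have hv0 : v = 0 := by
      by_contra hne'
      have hvp : 0 < v := lt_of_le_of_ne hv (Ne.symm hne')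
      have k1 := le_of_mul_le_mul_left hF hvp
      have k2 : 0 ≤ Y * (3 + x - Y / 3) := mul_nonneg hY (by linarith)
      have k3 : 2 * (1 - x) ≤ (1 - x) * (2 + x) := const_mul_le (by linarith) (by linarith)
      linarith
    have he0 : e = 0 := by
      have h2 : 2 * e ≤ e * (4 - 2 * l + x + Y - e) := const_mul_le he (by linarith)
      rw [hv0, zero_mul] at c3'
      linarith
    exact hne ⟨by linarith, by linarith⟩

/-- Every other point of the opposite face is closer than the farther candidate. -/
theorem oppDist_lt {s W : ℝ} (hs0 : -1 / 2 ≤ s) (hW1 : W ≤ 1 - s) (hW2 : -W ≤ 1 - s)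
    (hl : ¬(s = leftX x Y ∧ W = Y)) (hr : ¬(s = rightX x Y ∧ W = Y)) :
    oppDist (planeBary x Y) (planeBary s W) <
      √(27 / 4 + max ((1 / 2 - x - leftX x Y) ^ 2) ((1 / 2 - x - rightX x Y) ^ 2)) := by
  have m1 := le_max_left ((1 / 2 - x - leftX x Y) ^ 2) ((1 / 2 - x - rightX x Y) ^ 2)
  have m2 := le_max_right ((1 / 2 - x - leftX x Y) ^ 2) ((1 / 2 - x - rightX x Y) ^ 2)
  generalize hM : max ((1 / 2 - x - leftX x Y) ^ 2) ((1 / 2 - x - rightX x Y) ^ 2) = M at *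
  have key : ∀ {A}, 0 ≤ A → A < 27 / 4 + M → √A < √(27 / 4 + M) := fun h h' =>
    Real.sqrt_lt_sqrt h h'
  have q1 : 0 ≤ 27 / 4 - 3 * (W - Y) + (W - Y) ^ 2 / 3 + (1 / 2 - x - s) ^ 2 := by
    linarith [sq_nonneg (W - Y - 9 / 2), sq_nonneg (1 / 2 - x - s)]
  have q2 : 0 ≤ 27 / 4 + 3 * (W - Y) + (W - Y) ^ 2 / 3 + (1 / 2 - x - s) ^ 2 := by
    linarith [sq_nonneg (W - Y + 9 / 2), sq_nonneg (1 / 2 - x - s)]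
  rw [oppDist, dev3_upper, dev3_lower, dev3_left, dev3_right, dev3_left', dev3_right']
  simp only [min_lt_iff]
  rcases le_total s (leftX x Y) with h | h
  · rcases exists_dev3_lt_left hY hx h1 hs0 hW1 hW2 h hl with h | h | h
    · exact Or.inl (Or.inr (key q1 (by linarith)))
    · exact Or.inr (Or.inl (Or.inr (key q2 (by linarith))))
    · exact Or.inr (Or.inr (Or.inr (key (by positivity) (by linarith))))
  rcases le_total (rightX x Y) s with h' | h'
  · rcases exists_dev3_lt_right hY hx h1 hW1 hW2 h' hr with h | h | h
    · exact Or.inl (Or.inr (key q1 (by linarith)))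
    · exact Or.inr (Or.inl (Or.inr (key q2 (by linarith))))
    · exact Or.inl (Or.inl (key (by positivity) (by linarith)))
  have h0 := leftX_nonneg hY hx h1
  -- Between the candidates the offset lies between the two gaps, and a square is largest at an end
  -- of an interval.
  have hg : (1 / 2 - x - s) ^ 2 ≤ M := by
    rcases le_total 0 (1 / 2 - x - s) with hs | hs
    · exact (pow_le_pow_left₀ hs (by linarith) 2).trans m1
    · rw [← neg_sq]
      rw [← neg_sq (1 / 2 - x - rightX x Y)] at m2
      exact (pow_le_pow_left₀ (by linarith) (by linarith) 2).trans m2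
  rcases lt_trichotomy W Y with hW | hW | hW
  · refine Or.inr (Or.inl (Or.inr (key q2 ?_)))
    linarith [mul_pos (sub_pos.2 hW) (by linarith : 0 < 3 - (Y - W) / 3)]
  · refine Or.inl (Or.inr (key q1 ?_))
    have hsl : leftX x Y < s := lt_of_le_of_ne h fun e => hl ⟨e.symm, hW⟩
    have hsr : s < rightX x Y := lt_of_le_of_ne h' fun e => hr ⟨e, hW⟩
    subst hW
    have : (1 / 2 - x - s) ^ 2 < M := by
      rcases le_total 0 (1 / 2 - x - s) with hs | hs
      · exact (pow_lt_pow_left₀ (by linarith) hs two_ne_zero).trans_le m1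
      · rw [← neg_sq]
        rw [← neg_sq (1 / 2 - x - rightX x W)] at m2
        exact (pow_lt_pow_left₀ (by linarith) (by linarith) two_ne_zero).trans_le m2
    linarith
  · refine Or.inl (Or.inr (key q1 ?_))
    linarith [mul_pos (sub_pos.2 hW) (by linarith : 0 < 3 - (W - Y) / 3)]

end candidates

/-! ### The face and the fundamental domain in coordinates -/

theorem sqrt_three_sq : √3 * √3 = (3 : ℝ) := Real.mul_self_sqrt (by norm_num)

theorem sqrt_three_pos : 0 < √(3 : ℝ) := by positivity

theorem mem_face_iff {z : ℂ} :
    z ∈ face ↔ -1 / 2 ≤ z.re ∧ √3 * z.im ≤ 1 - z.re ∧ -(√3 * z.im) ≤ 1 - z.re := by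
  constructor
  · intro h
    obtain ⟨h1, h2, h3⟩ := face_subset h
    exact ⟨by linarith, by linarith, by linarith⟩
  · rintro ⟨h1, h2, h3⟩
    have hmem : ∀ w ∈ ({1, ⟨-1 / 2, √3 / 2⟩, ⟨-1 / 2, -(√3 / 2)⟩} : Set ℂ), w ∈ face :=
      fun w hw => subset_convexHull ℝ _ hw
    have hconv : Convex ℝ face := convex_convexHull ℝ _
    have h := hconv.sum_mem (t := Finset.univ)
      (w := planeBary z.re (√3 * z.im))
      (z := ![1, ⟨-1 / 2, √3 / 2⟩, ⟨-1 / 2, -(√3 / 2)⟩])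
      (fun m _ => (isBary_planeBary h1 h2 h3).nonneg m)
      (by rw [Fin.sum_univ_three]; exact (isBary_planeBary h1 h2 h3).sum)
      (by
        intro m _
        apply hmem
        fin_cases m <;> simp)
    convert h using 1
    rw [Fin.sum_univ_three]
    apply Complex.ext
    · simp [planeBary]
      ring
    · simp [planeBary]
      linear_combination (-(1 / 3) * z.im) * sqrt_three_sq

theorem mem_domainT_iff {z : ℂ} :
    z ∈ domainT ↔ 0 ≤ √3 * z.im ∧ √3 * z.im ≤ 3 * z.re ∧ √3 * z.im ≤ 1 - z.re := by
  have h3 := sqrt_three_sq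
  constructor
  · intro h
    have hsub : domainT ⊆
        {z | 0 ≤ √3 * z.im ∧ √3 * z.im ≤ 3 * z.re ∧ √3 * z.im ≤ 1 - z.re} := by
      refine convexHull_min ?_ ?_
      · rintro z (rfl | rfl | rfl)
        · norm_num
        · norm_num
        · refine ⟨?_, ?_, ?_⟩ <;> simp only [topVertex] <;> linarith
      · rintro z ⟨hz1, hz2, hz3⟩ w ⟨hw1, hw2, hw3⟩ a b ha hb hab
        obtain rfl : b = 1 - a := by linarith
        simp only [mem_ofPred_eq, Complex.add_re, Complex.add_im, Complex.real_smul,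
          Complex.mul_re, Complex.mul_im, Complex.ofReal_re, Complex.ofReal_im]
        refine ⟨?_, ?_, ?_⟩
        · linarith [mul_nonneg ha hz1, mul_nonneg hb hw1]
        · linarith [mul_nonneg ha (sub_nonneg.2 hz2), mul_nonneg hb (sub_nonneg.2 hw2)]
        · linarith [mul_nonneg ha (sub_nonneg.2 hz3), mul_nonneg hb (sub_nonneg.2 hw3)]
    exact hsub h
  · rintro ⟨hz1, hz2, hz3⟩
    have hmem : ∀ w ∈ ({0, 1, topVertex} : Set ℂ), w ∈ domainT :=
      fun w hw => subset_convexHull ℝ _ hw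
    have hconv : Convex ℝ domainT := convex_convexHull ℝ _
    have him : 0 ≤ z.im := (mul_nonneg_iff_of_pos_left sqrt_three_pos).1 hz1
    have h := hconv.sum_mem (t := Finset.univ)
      (w := ![1 - z.re - √3 * z.im, z.re - √3 * z.im / 3, 4 / 3 * (√3 * z.im)])
      (z := ![0, 1, topVertex])
      (by
        intro m _
        fin_cases m <;> simp <;> linarith)
      (by simp [Fin.sum_univ_three]; ring)
      (by
        intro m _
        apply hmem
        fin_cases m <;> simp)
    convert h using 1
    rw [Fin.sum_univ_three]
    apply Complex.ext
    · simp [topVertex]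
      ring
    · simp [topVertex]
      linear_combination (-(1 / 3) * z.im) * sqrt_three_sq

theorem coords_chart (z : face) :
    coords (chart z) = planeBary (z : ℂ).re (√3 * (z : ℂ).im) := by
  ext m
  fin_cases m <;> simp [coords, chart, chartMap, planeBary]

theorem leftBranch_eq {z : ℂ} (hz : z ∈ domainT) :
    leftBranch z = ⟨leftX z.re (√3 * z.im), z.im⟩ := by
  obtain ⟨h1, h2, h3⟩ := mem_domainT_iff.1 hz
  have hs := sqrt_three_sq
  unfold leftBranch leftX
  congr 1
  have hd : 6 - 3 * z.re - √3 * z.im ≠ 0 := by linarith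
  have hd' : √3 * z.re + z.im - 2 * √3 ≠ 0 := by
    intro h
    apply hd
    linear_combination (-√3) * h + (z.re - 2) * hs
  rw [div_eq_div_iff hd' hd]
  linear_combination ((-z.re * z.im - √3 * z.re + √3 * z.im ^ 2 - z.im) * (z.re - 2) +
    z.re * (√3 * z.re + z.im - 2 * √3)) * hs

theorem rightBranch_eq {z : ℂ} (hz : z ∈ domainT) :
    rightBranch z = ⟨rightX z.re (√3 * z.im), z.im⟩ := by
  obtain ⟨h1, h2, h3⟩ := mem_domainT_iff.1 hz
  have hs := sqrt_three_sq
  unfold rightBranch rightX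
  congr 1
  have hd : 3 * z.re + √3 * z.im + 3 ≠ 0 := by linarith
  have hd' : √3 * z.re + z.im + √3 ≠ 0 := by
    intro h
    apply hd
    linear_combination √3 * h - (z.re + 1) * hs
  rw [div_eq_div_iff hd' hd]
  linear_combination (2 * z.re * (√3 * z.re + z.im + √3) -
    (-z.re * z.im + 2 * √3 * z.re + √3 * z.im ^ 2 - z.im) * (z.re + 1)) * hs

theorem leftBranch_mem_face {z : ℂ} (hz : z ∈ domainT) : leftBranch z ∈ face := by
  obtain ⟨h1, h2, h3⟩ := mem_domainT_iff.1 hz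
  rw [leftBranch_eq hz, mem_face_iff]
  have := leftX_nonneg h1 h2 h3
  have := leftX_le h1 h2 h3
  exact ⟨by simp only; linarith, by simp only; linarith, by simp only; linarith⟩

theorem rightBranch_mem_face {z : ℂ} (hz : z ∈ domainT) : rightBranch z ∈ face := by
  obtain ⟨h1, h2, h3⟩ := mem_domainT_iff.1 hz
  rw [rightBranch_eq hz, mem_face_iff]
  have := le_rightX h1 h2 h3
  have := rightX_le h1 h2 h3
  exact ⟨by simp only; linarith, by simp only; linarith, by simp only; linarith⟩

/-! ### The set of farthest points -/

theorem surfDist_antipode_chart {a : Fin 3 → ℝ} (ha : IsBary a) (z : face) :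
    surfDist a (antipode (chart z)) = oppDist a (planeBary (z : ℂ).re (√3 * (z : ℂ).im)) := by
  have hz := mem_face_iff.1 z.2
  have hn := (isBary_planeBary hz.1 hz.2.1 hz.2.2).nonneg
  have hk : ∀ m, SignOK true (coords (antipode (chart z)) m) := by
    intro m
    simpa [SignOK, coords_antipode, coords_chart] using hn m
  rw [← faceDist_eq_surfDist ha (hk 0) (hk 1) (hk 2)]
  have hb : bary (antipode (chart z)) = planeBary (z : ℂ).re (√3 * (z : ℂ).im) := by
    ext m
    rw [bary, coords_antipode, coords_chart, abs_neg, abs_of_nonneg (hn m)]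
  rw [hb, faceDist]

theorem exists_eq_antipode_chart {q : octahedron} (hq : ∀ m, coords q m ≤ 0) :
    ∃ z : face, q = antipode (chart z) := by
  obtain ⟨s, W, hb, h0, h1, h2⟩ := exists_planeBary (isBary_bary q)
  have hs := sqrt_three_pos
  have hW : √3 * (W / √3) = W := mul_div_cancel₀ _ hs.ne'
  refine ⟨⟨⟨s, W / √3⟩, mem_face_iff.2 ⟨h0, ?_, ?_⟩⟩, ?_⟩
  · simpa only [hW] using h1
  · simpa only [hW] using h2
  · apply coords_injective
    ext m
    rw [coords_antipode, coords_chart]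
    simp only [hW, ← hb, bary, abs_of_nonpos (hq m), neg_neg]

theorem chart_injective : Function.Injective chart := by
  intro z w h
  have h' := congrArg coords h
  rw [coords_chart, coords_chart] at h'
  obtain ⟨h1, h2⟩ := planeBary_injective h'
  exact Subtype.ext (Complex.ext h1 (mul_left_cancel₀ sqrt_three_pos.ne' h2))

/-- The horizontal offset which determines the distance of the left candidate. -/
def leftGap (z : ℂ) : ℝ := 1 / 2 - z.re - leftX z.re (√3 * z.im)

/-- The horizontal offset which determines the distance of the right candidate. -/
def rightGap (z : ℂ) : ℝ := 1 / 2 - z.re - rightX z.re (√3 * z.im)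

/-- The farthest points are the antipodes of the candidates of larger offset. -/
theorem mem_farthestSet_pointT (z : domainT) (q : octahedron) :
    q ∈ farthestSet (pointT z) ↔
      (q = antipode (chart ⟨leftBranch z, leftBranch_mem_face z.2⟩) ∧
        rightGap z ^ 2 ≤ leftGap z ^ 2) ∨
      (q = antipode (chart ⟨rightBranch z, rightBranch_mem_face z.2⟩) ∧
        leftGap z ^ 2 ≤ rightGap z ^ 2) := by
  obtain ⟨h1, h2, h3⟩ := mem_domainT_iff.1 z.2
  have hp : coords (pointT z) = planeBary (z : ℂ).re (√3 * (z : ℂ).im) := coords_chart _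
  have ha : IsBary (planeBary (z : ℂ).re (√3 * (z : ℂ).im)) :=
    isBary_planeBary (by linarith) (by linarith) (by linarith)
  set L := antipode (chart ⟨leftBranch z, leftBranch_mem_face z.2⟩) with hL
  set R := antipode (chart ⟨rightBranch z, rightBranch_mem_face z.2⟩) with hR
  set a := planeBary (z : ℂ).re (√3 * (z : ℂ).im) with hadef
  have dL : surfDist a L = √(27 / 4 + leftGap z ^ 2) := by
    rw [hL, surfDist_antipode_chart ha]
    simp only [leftBranch_eq z.2]
    exact oppDist_leftX h1 h2 h3
  have dR : surfDist a R = √(27 / 4 + rightGap z ^ 2) := by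
    rw [hR, surfDist_antipode_chart ha]
    simp only [rightBranch_eq z.2]
    exact oppDist_rightX h1 h2 h3
  set M := max (leftGap z ^ 2) (rightGap z ^ 2) with hM
  have hopp : ∀ w : face, antipode (chart w) ≠ L → antipode (chart w) ≠ R →
      surfDist a (antipode (chart w)) < √(27 / 4 + M) := by
    intro w hwL hwR
    rw [surfDist_antipode_chart ha]
    obtain ⟨w1, w2, w3⟩ := mem_face_iff.1 w.2
    refine oppDist_lt h1 h2 h3 w1 w2 w3 ?_ ?_
    · rintro ⟨e1, e2⟩
      apply hwL
      rw [hL]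
      congr 2
      apply Subtype.ext
      simp only [leftBranch_eq z.2]
      exact Complex.ext e1 (mul_left_cancel₀ sqrt_three_pos.ne' e2)
    · rintro ⟨e1, e2⟩
      apply hwR
      rw [hR]
      congr 2
      apply Subtype.ext
      simp only [rightBranch_eq z.2]
      exact Complex.ext e1 (mul_left_cancel₀ sqrt_three_pos.ne' e2)
  have mL : √(27 / 4 + leftGap z ^ 2) ≤ √(27 / 4 + M) :=
    Real.sqrt_le_sqrt (by linarith [le_max_left (leftGap z ^ 2) (rightGap z ^ 2)])
  have mR : √(27 / 4 + rightGap z ^ 2) ≤ √(27 / 4 + M) :=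
    Real.sqrt_le_sqrt (by linarith [le_max_right (leftGap z ^ 2) (rightGap z ^ 2)])
  have hM0 : 0 ≤ M := le_max_of_le_left (sq_nonneg _)
  have hle : ∀ w : face, surfDist a (antipode (chart w)) ≤ √(27 / 4 + M) := by
    intro w
    by_cases hwL : antipode (chart w) = L
    · rw [hwL, dL]; exact mL
    by_cases hwR : antipode (chart w) = R
    · rw [hwR, dR]; exact mR
    exact (hopp w hwL hwR).le
  have hlt : ∀ r, r ≠ L → r ≠ R → surfDist a r < √(27 / 4 + M) := by
    intro r hrL hrR
    by_cases hr : ∃ m, 0 < coords r m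
    · refine surfDist_lt ha (by linarith) (fun b hb => ?_) r hr
      obtain ⟨s, W, rfl, s0, s1, s2⟩ := exists_planeBary hb
      have hW : √3 * (W / √3) = W := mul_div_cancel₀ _ sqrt_three_pos.ne'
      have := hle ⟨⟨s, W / √3⟩, mem_face_iff.2 ⟨s0, by simpa only [hW] using s1,
        by simpa only [hW] using s2⟩⟩
      rw [surfDist_antipode_chart ha] at this
      simpa only [hW] using this
    · push Not at hr
      obtain ⟨w, rfl⟩ := exists_eq_antipode_chart hr
      exact hopp w hrL hrR
  have hall : ∀ r, surfDist a r ≤ √(27 / 4 + M) := by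
    intro r
    by_cases hrL : r = L
    · rw [hrL, dL]; exact mL
    by_cases hrR : r = R
    · rw [hrR, dR]; exact mR
    exact (hlt r hrL hrR).le
  have hiff : ∀ u v : ℝ, √(27 / 4 + u ^ 2) ≤ √(27 / 4 + v ^ 2) ↔ u ^ 2 ≤ v ^ 2 := by
    intro u v
    rw [Real.sqrt_le_sqrt_iff (by positivity), add_le_add_iff_left]
  rw [mem_farthestSet_iff ha hp]
  constructor
  · intro h
    by_cases hqL : q = L
    · left
      refine ⟨hqL, ?_⟩
      have := h R
      rwa [hqL, dL, dR, hiff] at this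
    by_cases hqR : q = R
    · right
      refine ⟨hqR, ?_⟩
      have := h L
      rwa [hqR, dL, dR, hiff] at this
    exfalso
    have hq := hlt q hqL hqR
    rcases max_choice (leftGap z ^ 2) (rightGap z ^ 2) with hc | hc
    · have := h L
      rw [dL] at this
      rw [hM, hc] at hq
      linarith
    · have := h R
      rw [dR] at this
      rw [hM, hc] at hq
      linarith
  · rintro (⟨rfl, h⟩ | ⟨rfl, h⟩) r
    · rw [dL, ← max_eq_left h]
      exact hall r
    · rw [dR, ← max_eq_right h]
      exact hall r

/-! ### The curve `J` -/

/-- The polynomial whose zero set in `T` is `J` together with the top vertex. -/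
def curvePoly (x Y : ℝ) : ℝ := (2 + x) * (5 - 2 * x) * (1 - 4 * x) - (1 - x - Y) ^ 3

/-- Clearing the denominators of `leftX` and `rightX` turns the equality of the two distances into
the cubic equation of `J`. -/
theorem gap_mul {z : ℂ} (hz : z ∈ domainT) :
    (6 - 3 * z.re - √3 * z.im) * (3 * z.re + √3 * z.im + 3) * (leftGap z + rightGap z) =
      2 * curvePoly z.re (√3 * z.im) := by
  obtain ⟨h1, h2, h3⟩ := mem_domainT_iff.1 hz
  have hl := leftX_mul h1 h3
  have hr := rightX_mul h1 h2
  unfold leftGap rightGap curvePoly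
  generalize √3 * z.im = Y at *
  linear_combination (-(3 * z.re + Y + 3)) * hl - (6 - 3 * z.re - Y) * hr

theorem gap_factor_pos {z : ℂ} (hz : z ∈ domainT) :
    0 < (6 - 3 * z.re - √3 * z.im) * (3 * z.re + √3 * z.im + 3) := by
  obtain ⟨h1, h2, h3⟩ := mem_domainT_iff.1 hz
  exact mul_pos (by linarith) (by linarith)

/-- In the difference quotient the constant `-39` dominates, since all squares and mixed products
that occur are at most `1`. -/
theorem curvePoly_strictAnti {x₁ x₂ Y : ℝ} (h1 : 0 ≤ x₁) (h12 : x₁ < x₂) (hY : 0 ≤ Y)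
    (h2 : x₂ + Y ≤ 1) : curvePoly x₂ Y < curvePoly x₁ Y := by
  have k1 : 0 ≤ (x₂ - x₁) * (x₁ + x₂) := mul_nonneg (by linarith) (by linarith)
  have b1 : x₁ ^ 2 ≤ 1 := pow_le_one₀ h1 (by linarith)
  have b2 : x₂ ^ 2 ≤ 1 := pow_le_one₀ (by linarith) (by linarith)
  have b3 : x₁ * x₂ ≤ 1 := mul_le_one₀ (by linarith) (by linarith) (by linarith)
  have c1 : (1 - x₁ - Y) ^ 2 ≤ 1 := pow_le_one₀ (by linarith) (by linarith)
  have c2 : (1 - x₂ - Y) ^ 2 ≤ 1 := pow_le_one₀ (by linarith) (by linarith)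
  have c3 : (1 - x₁ - Y) * (1 - x₂ - Y) ≤ 1 :=
    mul_le_one₀ (by linarith) (by linarith) (by linarith)
  have k2 := mul_nonneg (sub_nonneg.2 h12.le)
    (by linarith : 0 ≤ 3 - x₁ ^ 2 - x₂ ^ 2 - x₁ * x₂)
  have k3 := mul_nonneg (sub_nonneg.2 h12.le)
    (by linarith : 0 ≤ 3 - (1 - x₁ - Y) ^ 2 - (1 - x₂ - Y) ^ 2 - (1 - x₁ - Y) * (1 - x₂ - Y))
  unfold curvePoly
  linarith

/-- Since `curvePoly x 0 = 9 (x³ - x² - 4x + 1)`, this sign keeps `J` on or above the base of `T`.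
-/
theorem cubic_nonpos_of_le {r x : ℝ} (hr0 : 0 < r) (hr : r ^ 3 - r ^ 2 - 4 * r + 1 = 0)
    (h : r ≤ x) (hx : x < 1 / 4) : x ^ 3 - x ^ 2 - 4 * x + 1 ≤ 0 := by
  have b1 : x ^ 2 ≤ 1 := pow_le_one₀ (by linarith) (by linarith)
  have b2 : r ^ 2 ≤ 1 := pow_le_one₀ (by linarith) (by linarith)
  have b3 : x * r ≤ 1 := mul_le_one₀ (by linarith) (by linarith) (by linarith)
  have := mul_nonneg (sub_nonneg.2 h) (by linarith : 0 ≤ 4 + x + r - x ^ 2 - x * r - r ^ 2)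
  linarith

theorem exists_cubic_root :
    ∃ r : ℝ, 0 < r ∧ r < 1 / 4 ∧ r ^ 3 - r ^ 2 - 4 * r + 1 = 0 := by
  have hc : ContinuousOn (fun r : ℝ => r ^ 3 - r ^ 2 - 4 * r + 1) (Icc 0 (1 / 4)) := by fun_prop
  obtain ⟨r, hr, h⟩ := intermediate_value_Ioo' (by norm_num) hc (show (0 : ℝ) ∈ Ioo _ _ by norm_num)
  exact ⟨r, hr.1, hr.2, h⟩

/-- Points of `J` lie in `T`, on the zero set of `curvePoly`. -/
theorem curveJ_spec {z : ℂ} (hz : z ∈ curveJ) :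
    z ∈ domainT ∧ z.re < 1 / 4 ∧ curvePoly z.re (√3 * z.im) = 0 := by
  obtain ⟨r, hr0, hr1, hr, hrz, hz4, him⟩ := hz
  have hs := sqrt_three_pos
  generalize hP : (2 + z.re) * (5 - 2 * z.re) * (1 - 4 * z.re) = P at him
  have hA : 1 ≤ (2 + z.re) * (5 - 2 * z.re) := by nlinarith
  have hP0 : 0 ≤ P := by
    rw [← hP]
    exact mul_nonneg (by linarith) (by linarith)
  obtain ⟨c, hc⟩ : ∃ c, c = P ^ (1 / 3 : ℝ) := ⟨_, rfl⟩
  rw [← hc] at him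
  have hc0 : 0 ≤ c := hc ▸ Real.rpow_nonneg hP0 _
  have hc3 : c ^ 3 = P := by
    rw [hc, ← Real.rpow_natCast, ← Real.rpow_mul hP0]
    norm_num
  have hY : √3 * z.im = 1 - z.re - c := by
    rw [him, ← mul_assoc, mul_one_div_cancel hs.ne', one_mul]
  have hcub := cubic_nonpos_of_le hr0 hr hrz hz4
  -- With `√3 y = 1 - x - c`, the bounds `c1` and `c2` are the inequalities `0 ≤ √3 y` and `√3 y ≤
  -- 3x` defining `T`; both are checked on cubes.
  have c1 : c ≤ 1 - z.re := by
    refine le_of_pow_le_pow_left₀ three_ne_zero (by linarith) ?_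
    rw [hc3, ← hP]
    linarith
  have c2 : 1 - 4 * z.re ≤ c := by
    refine le_of_pow_le_pow_left₀ three_ne_zero hc0 ?_
    rw [hc3, ← hP, pow_succ]
    refine mul_le_mul_of_nonneg_right ?_ (by linarith)
    exact (pow_le_one₀ (by linarith) (by linarith)).trans hA
  refine ⟨mem_domainT_iff.2 ⟨?_, ?_, ?_⟩, hz4, ?_⟩
  · linarith
  · linarith
  · linarith
  · rw [curvePoly, hY, hP, ← hc3]
    ring

/-- Below the top vertex every horizontal line through `T` meets `J`. -/
theorem exists_mem_curveJ {y : ℝ} (h0 : 0 ≤ √3 * y) (h1 : √3 * y < 3 / 4) :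
    ∃ w ∈ curveJ, w.im = y := by
  have hs := sqrt_three_pos
  obtain ⟨Y, hY⟩ : ∃ Y, Y = √3 * y := ⟨_, rfl⟩
  rw [← hY] at h0 h1
  have hcont : ContinuousOn (fun x : ℝ => curvePoly x Y) (Icc 0 (1 / 4)) := by
    unfold curvePoly
    fun_prop
  have e0 : 0 < curvePoly 0 Y := by
    have : (1 - 0 - Y) ^ 3 ≤ 1 := pow_le_one₀ (by linarith) (by linarith)
    unfold curvePoly
    linarith
  have e1 : curvePoly (1 / 4) Y < 0 := by
    have : 0 < (1 - 1 / 4 - Y) ^ 3 := pow_pos (by linarith) 3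
    unfold curvePoly
    linarith
  obtain ⟨x, ⟨hx0, hx1⟩, hx⟩ := intermediate_value_Ioo' (by norm_num) hcont ⟨e1, e0⟩
  obtain ⟨r, hr0, hr1, hr⟩ := exists_cubic_root
  simp only [curvePoly] at hx
  have hrx : r ≤ x := by
    by_contra! hlt
    have hp : (1 - x - Y) ^ 3 ≤ (1 - x) ^ 3 := pow_le_pow_left₀ (by linarith) (by linarith) 3
    have b1 : x ^ 2 ≤ 1 := pow_le_one₀ (by linarith) (by linarith)
    have b2 : r ^ 2 ≤ 1 := pow_le_one₀ (by linarith) (by linarith)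
    have b3 : x * r ≤ 1 := mul_le_one₀ (by linarith) (by linarith) (by linarith)
    have := mul_pos (sub_pos.2 hlt) (by linarith : 0 < 4 + x + r - x ^ 2 - x * r - r ^ 2)
    linarith
  refine ⟨⟨x, y⟩, ⟨r, hr0, hr1, hr, hrx, hx1, ?_⟩, rfl⟩
  simp only
  have hroot : ((2 + x) * (5 - 2 * x) * (1 - 4 * x)) ^ (1 / 3 : ℝ) = 1 - x - Y := by
    rw [sub_eq_zero.1 hx, one_div]
    exact Real.pow_rpow_inv_natCast (by linarith) three_ne_zero
  rw [hroot, hY]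
  field_simp
  ring

theorem leftOfJ_or_rightOfJ {z : ℂ} (hz : z ∈ domainT) (hJ : z ∉ curveJ) :
    LeftOfJ z ∨ RightOfJ z ∨ z = topVertex := by
  obtain ⟨h1, h2, h3⟩ := mem_domainT_iff.1 hz
  rcases lt_or_ge (√3 * z.im) (3 / 4) with h | h
  · obtain ⟨w, hw, him⟩ := exists_mem_curveJ h1 h
    rcases lt_trichotomy z.re w.re with hlt | heq | hgt
    · exact Or.inl ⟨w, hw, him, hlt⟩
    · exact absurd (Complex.ext heq him.symm ▸ hw) hJ
    · exact Or.inr (Or.inl ⟨w, hw, him, hgt⟩)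
  · right; right
    apply Complex.ext
    · simp only [topVertex]; linarith
    · simp only [topVertex]
      apply mul_left_cancel₀ sqrt_three_pos.ne'
      linarith [sqrt_three_sq]

theorem gap_pos_of_leftOfJ {z : ℂ} (hz : z ∈ domainT) (h : LeftOfJ z) :
    0 < leftGap z + rightGap z := by
  obtain ⟨w, hw, him, hlt⟩ := h
  obtain ⟨hwT, -, hw0⟩ := curveJ_spec hw
  obtain ⟨h1, h2, h3⟩ := mem_domainT_iff.1 hz
  obtain ⟨-, -, k3⟩ := mem_domainT_iff.1 hwT
  rw [him] at k3 hw0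
  have := curvePoly_strictAnti (by linarith) hlt h1 (by linarith)
  have hg := gap_mul hz
  exact pos_of_mul_pos_right (by linarith) (gap_factor_pos hz).le

theorem gap_neg_of_rightOfJ {z : ℂ} (hz : z ∈ domainT) (h : RightOfJ z) :
    leftGap z + rightGap z < 0 := by
  obtain ⟨w, hw, him, hlt⟩ := h
  obtain ⟨hwT, -, hw0⟩ := curveJ_spec hw
  obtain ⟨h1, h2, h3⟩ := mem_domainT_iff.1 hz
  obtain ⟨-, k2, -⟩ := mem_domainT_iff.1 hwT
  rw [him] at k2 hw0
  have := curvePoly_strictAnti (by linarith) hlt h1 (by linarith)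
  have hg := gap_mul hz
  exact neg_of_mul_neg_right (by linarith) (gap_factor_pos hz).le

/-- With the order of the gaps known, their squares are compared by the sign of their sum alone. -/
theorem rightGap_le_leftGap {z : ℂ} (hz : z ∈ domainT) : rightGap z ≤ leftGap z := by
  obtain ⟨h1, h2, h3⟩ := mem_domainT_iff.1 hz
  have := leftX_le h1 h2 h3
  have := le_rightX h1 h2 h3
  unfold leftGap rightGap
  linarith

theorem branch_eq_of_gap_eq {z : ℂ} (hz : z ∈ domainT) (h : leftGap z = rightGap z) :
    leftBranch z = rightBranch z := by
  rw [leftBranch_eq hz, rightBranch_eq hz]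
  unfold leftGap rightGap at h
  congr 1
  linarith

/-- The second alternative covers the top vertex, where the two candidates coincide. -/
theorem farthestSet_of_gap_nonneg (z : domainT)
    (h : 0 < leftGap z + rightGap z ∨ leftGap z = rightGap z) :
    farthestSet (pointT z) = {antipode (chart ⟨leftBranch z, leftBranch_mem_face z.2⟩)} := by
  have hle := rightGap_le_leftGap z.2
  ext q
  rw [mem_farthestSet_pointT, mem_singleton_iff]
  constructor
  · rintro (⟨hq, -⟩ | ⟨hq, hsq⟩)
    · exact hq
    · have heq : leftGap z = rightGap z := by
        rcases h with h | h
        · nlinarith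
        · exact h
      rw [hq]
      congr 3
      exact (branch_eq_of_gap_eq z.2 heq).symm
  · intro hq
    refine Or.inl ⟨hq, ?_⟩
    rcases h with h | h
    · nlinarith
    · rw [h]

theorem farthestSet_of_gap_neg (z : domainT) (h : leftGap z + rightGap z < 0) :
    farthestSet (pointT z) = {antipode (chart ⟨rightBranch z, rightBranch_mem_face z.2⟩)} := by
  have hle := rightGap_le_leftGap z.2
  ext q
  rw [mem_farthestSet_pointT, mem_singleton_iff]
  constructor
  · rintro (⟨hq, hsq⟩ | ⟨hq, -⟩)
    · have heq : leftGap z = rightGap z := by nlinarith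
      rw [hq]
      congr 3
      exact branch_eq_of_gap_eq z.2 heq
    · exact hq
  · intro hq
    exact Or.inr ⟨hq, by nlinarith⟩

theorem farAntipode_eq {p q : octahedron} (hq : farthestSet p = {antipode q})
    (h : p ∈ uniqueFar) : farAntipode ⟨p, h⟩ = q := by
  have h1 : farthestSet p = {farPoint ⟨p, h⟩} := h.choose_spec
  rw [hq] at h1
  rw [farAntipode, ← singleton_injective h1, antipode_antipode]

theorem top_candidates : leftX (1 / 4) (3 / 4) = 1 / 4 ∧ rightX (1 / 4) (3 / 4) = 1 / 4 := by
  constructor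
  · norm_num [leftX]
  · norm_num [rightX]

theorem sqrt_three_mul_topVertex_im : √3 * topVertex.im = 3 / 4 := by
  simp only [topVertex]
  linarith [sqrt_three_sq]

theorem leftGap_topVertex : leftGap topVertex = rightGap topVertex := by
  unfold leftGap rightGap
  rw [sqrt_three_mul_topVertex_im]
  simp only [topVertex, top_candidates]

theorem leftBranch_topVertex (h : topVertex ∈ domainT) : leftBranch topVertex = topVertex := by
  rw [leftBranch_eq h, sqrt_three_mul_topVertex_im]
  apply Complex.ext
  · simp only [topVertex, top_candidates]
  · rfl

theorem antipode_image_farthestSet {z : ℂ} (hz : z ∈ curveJ) (hT : z ∈ domainT) :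
    antipode '' farthestSet (pointT ⟨z, hT⟩) =
      {chart ⟨leftBranch z, leftBranch_mem_face hT⟩,
        chart ⟨rightBranch z, rightBranch_mem_face hT⟩} := by
  have hg : leftGap z + rightGap z = 0 := by
    have h := gap_mul hT
    rw [(curveJ_spec hz).2.2, mul_zero] at h
    exact (mul_eq_zero.1 h).resolve_left (gap_factor_pos hT).ne'
  have hsq : leftGap z ^ 2 = rightGap z ^ 2 := by
    rw [eq_neg_of_add_eq_zero_left hg, neg_sq]
  have hset : farthestSet (pointT ⟨z, hT⟩) =
      {antipode (chart ⟨leftBranch z, leftBranch_mem_face hT⟩),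
        antipode (chart ⟨rightBranch z, rightBranch_mem_face hT⟩)} := by
    ext q
    rw [mem_farthestSet_pointT]
    simp only [hsq, le_refl, and_true, mem_insert_iff, mem_singleton_iff]
  rw [hset, image_pair, antipode_antipode, antipode_antipode]

theorem leftBranch_ne_rightBranch {z : ℂ} (hz : z ∈ curveJ) : leftBranch z ≠ rightBranch z := by
  obtain ⟨hT, h4, h0⟩ := curveJ_spec hz
  obtain ⟨h1, h2, h3⟩ := mem_domainT_iff.1 hT
  have h := gap_mul hT
  rw [h0, mul_zero] at h
  have hg := (mul_eq_zero.1 h).resolve_left (gap_factor_pos hT).ne'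
  have k1 := leftX_le h1 h2 h3
  have k2 := le_rightX h1 h2 h3
  intro heq
  rw [leftBranch_eq hT, rightBranch_eq hT] at heq
  have hre := congrArg Complex.re heq
  simp only at hre
  unfold leftGap rightGap at hg
  linarith

end OctahedronFarpoint

end

/-! ### The main theorem -/

open OctahedronFarpoint in
theorem mainTheorem1 :
    -- the antipodal map commutes with the farthest-point map, so that `f = F ∘ A = A ∘ F`
    (∀ p : octahedron, farthestSet (antipode p) = antipode '' farthestSet p) ∧
    -- every point of `T - J` is to the left of `J`, to the right of `J`, or the top vertex
    (∀ z ∈ domainT, z ∉ curveJ → LeftOfJ z ∨ RightOfJ z ∨ z = topVertex) ∧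
    -- points of `T - J`
    (∀ z : domainT, (z : ℂ) ∉ curveJ →
      ∃ h : pointT z ∈ uniqueFar,
        (LeftOfJ z → ∃ hl : leftBranch z ∈ face,
          farAntipode ⟨pointT z, h⟩ = chart ⟨leftBranch z, hl⟩) ∧
        (RightOfJ z → ∃ hr : rightBranch z ∈ face,
          farAntipode ⟨pointT z, h⟩ = chart ⟨rightBranch z, hr⟩) ∧
        ((z : ℂ) = topVertex → farAntipode ⟨pointT z, h⟩ = pointT z)) ∧
    -- points of `J`
    (∀ z ∈ curveJ, ∃ (hz : z ∈ domainT) (hl : leftBranch z ∈ face) (hr : rightBranch z ∈ face),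
      antipode '' farthestSet (pointT ⟨z, hz⟩) =
          {chart ⟨leftBranch z, hl⟩, chart ⟨rightBranch z, hr⟩} ∧
        chart ⟨leftBranch z, hl⟩ ≠ chart ⟨rightBranch z, hr⟩) ∧
    -- both formulas are linear fractional in `x`, with related coefficients
    (∀ z ∈ domainT,
      leftBranch z = ⟨(coeffA z.im * z.re + coeffB z.im) / (coeffC z.im * z.re + coeffD z.im),
        z.im⟩ ∧
      rightBranch z = ⟨(coeffD z.im * z.re - coeffB z.im) / (-coeffC z.im * z.re + coeffA z.im),
        z.im⟩) := by
  refine ⟨farthestSet_antipode, fun z hz hJ => leftOfJ_or_rightOfJ hz hJ, ?_, ?_, ?_⟩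
  · intro z hJ
    have hleft : LeftOfJ z → farthestSet (pointT z) =
        {antipode (chart ⟨leftBranch z, leftBranch_mem_face z.2⟩)} := fun h =>
      farthestSet_of_gap_nonneg z (Or.inl (gap_pos_of_leftOfJ z.2 h))
    have hright : RightOfJ z → farthestSet (pointT z) =
        {antipode (chart ⟨rightBranch z, rightBranch_mem_face z.2⟩)} := fun h =>
      farthestSet_of_gap_neg z (gap_neg_of_rightOfJ z.2 h)
    have htop : (z : ℂ) = topVertex → farthestSet (pointT z) = {antipode (pointT z)} := by
      intro h
      rw [farthestSet_of_gap_nonneg z (Or.inr (by rw [h, leftGap_topVertex]))]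
      have hb : leftBranch z = z := by
        rw [h]
        exact leftBranch_topVertex (h ▸ z.2)
      congr 2
      exact congrArg chart (Subtype.ext hb)
    have hu : pointT z ∈ uniqueFar := by
      rcases leftOfJ_or_rightOfJ z.2 hJ with h | h | h
      · exact ⟨_, hleft h⟩
      · exact ⟨_, hright h⟩
      · exact ⟨_, htop h⟩
    exact ⟨hu, fun h => ⟨leftBranch_mem_face z.2, farAntipode_eq (hleft h) hu⟩,
      fun h => ⟨rightBranch_mem_face z.2, farAntipode_eq (hright h) hu⟩,
      fun h => farAntipode_eq (htop h) hu⟩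
  · intro z hz
    have hT := (curveJ_spec hz).1
    refine ⟨hT, leftBranch_mem_face hT, rightBranch_mem_face hT,
      antipode_image_farthestSet hz hT, fun h => ?_⟩
    exact leftBranch_ne_rightBranch hz (congrArg Subtype.val (chart_injective h))
  · intro z _
    refine ⟨?_, ?_⟩
    · unfold leftBranch coeffA coeffB coeffC coeffD
      congr 2 <;> ring
    · unfold rightBranch coeffA coeffB coeffC coeffD
      congr 1
      rw [← neg_div_neg_eq]
      congr 1 <;> ring
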